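/- For $s=\sigma+it\in\mathbb C$ let $$\mathcal R(s)=\int_{0\swarrow1}\frac{x^{-s}e^{\pi i x^2}}{e^{\pi i x}-e^{-\pi i x}}\,dx$$ be Riemann's auxiliary function, where $0\swarrow1$ denotes the straight line of direction $e^{-3\pi i/4}$ crossing the real axis between $0$ and $1$ (say $x=\frac12+ue^{-3\pi i/4}$ with $u$ increasing from $-\infty$ to $+\infty$) and $x^{-s}$ is the principal branch. Let $\chi(s)=2^s\pi^{s-1}\sin(\pi s/2)\Gamma(1-s)$ be the factor of the functional equation $\zeta(s)=\chi(s)\zeta(1-s)$. For $0<\arg(s-1)<2\pi$ let $\eta=\eta(s)$ be the square root of $\frac{s-1}{2\pi i}$ with $-\frac{\pi}{4}<\arg\eta<\frac{3\pi}{4}$, and let $\eta^{s-1}$ be the principal power. Then there are constants $A>0$, $t_0>0$ and $C>0$ such that for every $s=\sigma+it$ with $t>t_0$ and $1-\sigma\ge A\,t^{2/5}\log t$ we have $$\mathcal R(s)=-\chi(s)\,\eta^{s-1}e^{-\pi i\eta^2}\,\frac{\sqrt2\,e^{3\pi i/8}\sin\pi\eta}{2\cos2\pi\eta}\,(1+U)$$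 with a complex number $U=U(s)$ satisfying $|U|<1$ and $|U|\le C(\log t)^{-1/5}$. -/

import Mathlib

noncomputable section

namespace RiemannAux

open Complex MeasureTheory

/-- The integrand `x^{-s} e^{π i x²} / (e^{π i x} - e^{-π i x})`, with the principal branch of
`x^{-s}` (the path of integration below does not meet the cut `(-∞, 0]`). -/
def kernel (s x : ℂ) : ℂ :=
  x ^ (-s) * exp (Real.pi * I * x ^ 2) / (exp (Real.pi * I * x) - exp (-(Real.pi * I * x)))

/-- Riemann's auxiliary function `ℛ(s)`: the integral of `kernel s` along `0 ↙ 1`, the line of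
slope `1` that crosses the real axis between `0` and `1` (here at `1/2`), run downwards to the
left. It is parametrized as `x = 1/2 + u e^{-3πi/4}`, `u ∈ ℝ`. -/
def auxR (s : ℂ) : ℂ :=
  ∫ u : ℝ, kernel s (1 / 2 + u * exp (-(3 * Real.pi * I / 4))) * exp (-(3 * Real.pi * I / 4))

/-- The factor `χ(s) = 2^s π^{s-1} sin(πs/2) Γ(1-s)` of the functional equation
`ζ(s) = χ(s) ζ(1-s)`. -/
def chi (s : ℂ) : ℂ :=
  2 ^ s * (Real.pi : ℂ) ^ (s - 1) * sin (Real.pi * s / 2) * Gamma (1 - s)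

/-- The square root `η` of `(s-1)/(2πi)` with `-π/4 < arg η < 3π/4`, for `0 < arg (s-1) < 2π`;
see `eta_sq` and `arg_eta`. -/
def eta (s : ℂ) : ℂ :=
  exp (Real.pi * I / 4) * ((1 - s) / (2 * Real.pi)) ^ (1 / 2 : ℂ)

theorem eta_sq (s : ℂ) : eta s ^ 2 = (s - 1) / (2 * Real.pi * I) := by
  have h1 : exp (Real.pi * I / 4) ^ 2 = I := by
    rw [← Complex.exp_nat_mul, show ((2 : ℕ) : ℂ) * (Real.pi * I / 4) = Real.pi / 2 * I by
      push_cast; ring]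
    exact exp_pi_div_two_mul_I
  have h2 : (((1 - s) / (2 * Real.pi)) ^ (1 / 2 : ℂ)) ^ 2 = (1 - s) / (2 * Real.pi) := by
    simp
  have hp : (Real.pi : ℂ) ≠ 0 := by exact_mod_cast Real.pi_ne_zero
  rw [eta, mul_pow, h1, h2]
  field_simp [I_ne_zero]
  rw [I_sq]
  ring

/-- The hypothesis says that `s - 1` is not in `[0, ∞)`, that is, that its argument can be taken
in `(0, 2π)`. -/
theorem arg_eta (s : ℂ) (hs : 1 - s ∈ slitPlane) :
    arg (eta s) ∈ Set.Ioo (-(Real.pi / 4)) (3 * Real.pi / 4) := by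
  have hpi := Real.pi_pos
  set z : ℂ := (1 - s) / (2 * Real.pi) with hz
  have hz' : z = ((2 * Real.pi)⁻¹ : ℝ) * (1 - s) := by
    rw [hz]; push_cast; rw [div_eq_inv_mul]
  have harg : arg z = arg (1 - s) := by
    rw [hz', arg_real_mul _ (by positivity)]
  have hlt : arg z < Real.pi := by
    rw [harg]
    exact lt_of_le_of_ne (arg_le_pi _) (mem_slitPlane_iff_arg.1 hs).1
  have hgt : -Real.pi < arg z := neg_pi_lt_arg z
  have hz0 : z ≠ 0 := by
    rw [hz']
    refine mul_ne_zero ?_ (slitPlane_ne_zero hs)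
    exact_mod_cast (by positivity : ((2 * Real.pi)⁻¹ : ℝ) ≠ 0)
  have key : eta s = exp ((Real.log ‖z‖ / 2 : ℝ) + ((Real.pi / 4 + arg z / 2 : ℝ)) * I) := by
    rw [eta, ← hz, cpow_def_of_ne_zero hz0, ← Complex.exp_add, log]
    congr 1
    push_cast
    ring
  have : arg (eta s) = Real.pi / 4 + arg z / 2 := by
    rw [key, Complex.exp_add, ← ofReal_exp, arg_real_mul _ (Real.exp_pos _),
      arg_exp_mul_I, toIocMod_eq_self]
    constructor <;> linarith
  rw [this]
  constructor <;> linarith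

/-- The main term
`-χ(s) η^{s-1} e^{-π i η²} · √2 e^{3πi/8} sin(πη) / (2 cos(2πη))`, `η = η(s)`. -/
def mainTerm (s : ℂ) : ℂ :=
  -chi s * eta s ^ (s - 1) * exp (-(Real.pi * I * eta s ^ 2)) *
    ((Real.sqrt 2 : ℂ) * exp (3 * Real.pi * I / 8) * sin (Real.pi * eta s) /
      (2 * cos (2 * Real.pi * eta s)))

end RiemannAux

end

/-!
Shifting the line of integration to the one of the same direction through `0` and eliminating
`1 / sin` with Mordell's integral, Fubini and the integral of `Gamma` give, for `Re s < -1`,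

`auxR s = chi s * (∑_{n > N} n ^ (s - 1) - ∫ x ^ (s - 1) e^{-π i x²} / (2 i sin π x) dx)`,

the integral being along the line of direction `e^{-π i / 4}` through `N + 1 / 2`. The function
`x ^ (s - 1) e^{-π i x²}` has a saddle point at `η = eta s`, where it looks like its value there
times the Gaussian `e^{-2 π i (x - η)²}`. For the Gaussian itself the sum is geometric and the
integral is again Mordell's, so that the difference is known exactly: it is the main term. With
`N = ⌊Re η + Im η⌋` the line passes close to the saddle point, the cubic error in the exponent is
harmless on it and on the rest of the sum, and for `η = X + i y` the resulting relative error is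
`O(1 / (X min(y, 1)⁵))`. Since `1 - σ = 4 π X y` and `t = 2 π (X² - y²)`, this is
`O(t² / (1 - σ)⁵ + t^{-1/2})`.
-/

namespace RiemannAux

open Complex MeasureTheory Filter Set

open scoped ComplexConjugate Real Topology

/-! ### Residue theorem in a horizontal strip -/

/-- Decay of `F` at both ends of the horizontal strip `α ≤ Im z ≤ β`, uniform across the strip.
This is what lets the vertical sides of a rectangle be discarded. -/
def VanishesAtStripEnds (F : ℂ → ℂ) (α β : ℝ) : Prop :=
  ∃ g : ℝ → ℝ, Tendsto g atTop (𝓝 0) ∧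
    ∀ u τ : ℝ, 1 ≤ |u| → τ ∈ Icc α β → ‖F (u + τ * I)‖ ≤ g |u|

theorem intervalIntegral_sub_eq_of_strip {F : ℂ → ℂ} {α β : ℝ} (hαβ : α ≤ β)
    (hc : ContinuousOn F {z | z.im ∈ Icc α β}) (hd : DifferentiableOn ℂ F {z | z.im ∈ Ioo α β})
    (R : ℝ) :
    (∫ u in (-R)..R, F (u + α * I)) - (∫ u in (-R)..R, F (u + β * I)) =
      I * (∫ τ in α..β, F (((-R : ℝ) : ℂ) + τ * I)) - I * (∫ τ in α..β, F ((R : ℂ) + τ * I)) := by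
  have h := integral_boundary_rect_eq_zero_of_continuousOn_of_differentiableOn F
    (⟨-R, α⟩ : ℂ) ⟨R, β⟩
    (hc.mono fun z hz => by simpa only [mem_ofPred_eq, mem_preimage, uIcc_of_le hαβ] using hz.2)
    (hd.mono fun z hz => by
      simpa only [mem_ofPred_eq, mem_preimage, min_eq_left hαβ, max_eq_right hαβ] using hz.2)
  simp only [smul_eq_mul] at h
  linear_combination h

theorem tendsto_intervalIntegral_sub_of_strip {F : ℂ → ℂ} {α β : ℝ} (hαβ : α ≤ β)
    (hc : ContinuousOn F {z | z.im ∈ Icc α β}) (hd : DifferentiableOn ℂ F {z | z.im ∈ Ioo α β})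
    (hF : VanishesAtStripEnds F α β) :
    Tendsto (fun R : ℝ => (∫ u in (-R)..R, F (u + α * I)) - ∫ u in (-R)..R, F (u + β * I))
      atTop (𝓝 0) := by
  obtain ⟨g, hg, hFg⟩ := hF
  have norm_side_le : ∀ x : ℝ, 1 ≤ |x| →
      ‖I * ∫ τ in α..β, F ((x : ℂ) + τ * I)‖ ≤ g |x| * |β - α| := fun x hx => by
    rw [norm_mul, norm_I, one_mul]
    refine intervalIntegral.norm_integral_le_of_norm_le_const fun τ hτ => ?_
    rw [uIoc_of_le hαβ] at hτ
    exact hFg x τ hx ⟨hτ.1.le, hτ.2⟩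
  have hlim : Tendsto (fun R => g R * |β - α| + g R * |β - α|) atTop (𝓝 0) := by
    simpa only [zero_mul, add_zero] using (hg.mul_const |β - α|).add (hg.mul_const |β - α|)
  refine squeeze_zero_norm' ?_ hlim
  filter_upwards [eventually_ge_atTop 1] with R hR
  have hR0 : |R| = R := abs_of_nonneg (by linarith)
  rw [intervalIntegral_sub_eq_of_strip hαβ hc hd]
  refine (norm_sub_le _ _).trans (add_le_add ?_ ?_)
  · simpa only [abs_neg, hR0] using norm_side_le (-R) (by rwa [abs_neg, hR0])
  · simpa only [hR0] using norm_side_le R (by rwa [hR0])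

theorem integral_eq_of_strip {F : ℂ → ℂ} {α β : ℝ} (hαβ : α ≤ β)
    (hc : ContinuousOn F {z | z.im ∈ Icc α β}) (hd : DifferentiableOn ℂ F {z | z.im ∈ Ioo α β})
    (hF : VanishesAtStripEnds F α β)
    (hα : Integrable fun u : ℝ => F (u + α * I)) (hβ : Integrable fun u : ℝ => F (u + β * I)) :
    ∫ u : ℝ, F (u + α * I) = ∫ u : ℝ, F (u + β * I) :=
  sub_eq_zero.1 <| tendsto_nhds_unique
    ((intervalIntegral_tendsto_integral hα tendsto_neg_atTop_atBot tendsto_id).sub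
      (intervalIntegral_tendsto_integral hβ tendsto_neg_atTop_atBot tendsto_id))
    (tendsto_intervalIntegral_sub_of_strip hαβ hc hd hF)

theorem ofReal_add_mul_I_ne_zero {τ : ℝ} (hτ : τ ≠ 0) (u : ℝ) : (u : ℂ) + τ * I ≠ 0 := fun h =>
  hτ (by simpa only [add_im, ofReal_im, im_ofReal_mul, I_im, mul_one, zero_add, zero_im]
    using congrArg im h)

theorem one_div_sub_one_div_conj {ε : ℝ} (hε : 0 < ε) (u : ℝ) :
    1 / ((u : ℂ) + (-ε : ℝ) * I) - 1 / ((u : ℂ) + ε * I) =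
      ((2 / ε * (1 + (ε⁻¹ * u) ^ 2)⁻¹ : ℝ) : ℂ) * I := by
  have hmul : ((u : ℂ) + (-ε : ℝ) * I) * ((u : ℂ) + ε * I) = ((ε ^ 2 + u ^ 2 : ℝ) : ℂ) := by
    push_cast; linear_combination (-(ε : ℂ) ^ 2) * I_sq
  have hpoisson : (2 / ε * (1 + (ε⁻¹ * u) ^ 2)⁻¹ : ℝ) = 2 * ε / (ε ^ 2 + u ^ 2) := by
    have : ε ^ 2 + u ^ 2 ≠ 0 := by positivity
    field_simp
  rw [hpoisson, div_sub_div _ _ (ofReal_add_mul_I_ne_zero (neg_ne_zero.2 hε.ne') u)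
    (ofReal_add_mul_I_ne_zero hε.ne' u), hmul]
  push_cast
  ring

theorem integrable_one_div_sub_one_div_conj {ε : ℝ} (hε : 0 < ε) :
    Integrable fun u : ℝ => 1 / ((u : ℂ) + (-ε : ℝ) * I) - 1 / ((u : ℂ) + ε * I) := by
  simp only [one_div_sub_one_div_conj hε]
  exact ((integrable_inv_one_add_sq.comp_mul_left' (inv_ne_zero hε.ne')).const_mul
    _).ofReal.mul_const _

theorem integral_one_div_sub_one_div_conj {ε : ℝ} (hε : 0 < ε) :
    ∫ u : ℝ, (1 / ((u : ℂ) + (-ε : ℝ) * I) - 1 / ((u : ℂ) + ε * I)) = 2 * π * I := by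
  simp only [one_div_sub_one_div_conj hε]
  rw [integral_mul_const, integral_complex_ofReal, integral_const_mul,
    Measure.integral_comp_mul_left (fun x : ℝ => (1 + x ^ 2)⁻¹), integral_univ_inv_one_add_sq,
    inv_inv, abs_of_pos hε, smul_eq_mul, show 2 / ε * (ε * π) = 2 * π by field_simp]
  push_cast; ring

theorem VanishesAtStripEnds.sub_mul_one_div {F : ℂ → ℂ} {α β : ℝ}
    (hF : VanishesAtStripEnds F α β) (k : ℂ) :
    VanishesAtStripEnds (fun p => F p - k * (1 / p)) α β := by
  obtain ⟨g, hg, hFg⟩ := hF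
  refine ⟨fun x => g x + ‖k‖ * x⁻¹, ?_, fun u τ hu hτ => ?_⟩
  · simpa only [mul_zero, add_zero] using hg.add (tendsto_inv_atTop_zero.const_mul ‖k‖)
  · have hre : |u| ≤ ‖(u : ℂ) + τ * I‖ := by
      simpa only [add_re, ofReal_re, re_ofReal_mul, I_re, mul_zero, add_zero]
        using abs_re_le_norm ((u : ℂ) + τ * I)
    refine (norm_sub_le _ _).trans (add_le_add (hFg u τ hu hτ) ?_)
    rw [norm_mul, one_div, norm_inv]
    gcongr

theorem VanishesAtStripEnds.congr {F H : ℂ → ℂ} {α β : ℝ} (hF : VanishesAtStripEnds F α β)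
    (h : ∀ p : ℂ, p.im ∈ Icc α β → p ≠ 0 → H p = F p) : VanishesAtStripEnds H α β := by
  obtain ⟨g, hg, hFg⟩ := hF
  refine ⟨g, hg, fun u τ hu hτ => ?_⟩
  have hne : (u : ℂ) + τ * I ≠ 0 := fun h0 => by
    have hu0 : u = 0 := by simpa using congrArg re h0
    norm_num [hu0] at hu
  rw [h _ (by simpa using hτ) hne]
  exact hFg u τ hu hτ

/- Subtracting the polar part `φ 0 / p` leaves the function `dslope φ 0`, to which Cauchy's theorem
applies; the polar part contributes the Poisson integral. -/
theorem integral_strip_sub_eq_two_pi_I_mul {F φ : ℂ → ℂ} {ε : ℝ} (hε : 0 < ε) {V : Set ℂ}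
    (hVo : IsOpen V) (hV : {z : ℂ | z.im ∈ Icc (-ε) ε} ⊆ V) (hφ : DifferentiableOn ℂ φ V)
    (hFφ : ∀ p ∈ V, p ≠ 0 → F p = φ p / p) (hF : VanishesAtStripEnds F (-ε) ε)
    (hα : Integrable fun u : ℝ => F (u + (-ε : ℝ) * I))
    (hβ : Integrable fun u : ℝ => F (u + ε * I)) :
    (∫ u : ℝ, F (u + (-ε : ℝ) * I)) - ∫ u : ℝ, F (u + ε * I) = 2 * π * I * φ 0 := by
  set H : ℂ → ℂ := dslope φ 0 with hH
  have hHd : DifferentiableOn ℂ H V :=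
    (differentiableOn_dslope (hVo.mem_nhds (hV ⟨neg_nonpos.2 hε.le, hε.le⟩))).2 hφ
  have hHF : ∀ p ∈ V, p ≠ 0 → H p = F p - φ 0 * (1 / p) := fun p hp hp0 => by
    rw [hH, dslope_of_ne _ hp0, slope_def_field, hFφ p hp hp0, sub_zero]
    ring
  have hlimH := tendsto_intervalIntegral_sub_of_strip (by linarith) (hHd.continuousOn.mono hV)
    (hHd.mono fun z hz => hV (Ioo_subset_Icc_self hz))
    ((hF.sub_mul_one_div (φ 0)).congr fun p hp hp0 => hHF p (hV hp) hp0)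
  have hlimF := (intervalIntegral_tendsto_integral (hα.sub hβ) tendsto_neg_atTop_atBot
    tendsto_id).sub ((intervalIntegral_tendsto_integral (integrable_one_div_sub_one_div_conj hε)
      tendsto_neg_atTop_atBot tendsto_id).const_mul (φ 0))
  have hline : ∀ u τ : ℝ, τ ∈ Icc (-ε) ε → (u : ℂ) + τ * I ∈ V := fun u τ h => hV (by simpa using h)
  have hbot : -ε ∈ Icc (-ε) ε := ⟨le_rfl, by linarith⟩
  have htop : ε ∈ Icc (-ε) ε := ⟨by linarith, le_rfl⟩
  have hHint : ∀ τ ∈ Icc (-ε) ε, ∀ R,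
      IntervalIntegrable (fun u : ℝ => H (u + τ * I)) volume (-R) R := fun τ hτ R =>
    (hHd.continuousOn.comp_continuous (by fun_prop) fun u => hline u τ hτ).intervalIntegrable _ _
  have hzero := tendsto_nhds_unique (hlimF.congr fun R => ?_) hlimH
  · simp only [Pi.sub_apply, integral_one_div_sub_one_div_conj hε] at hzero
    rw [integral_sub hα hβ] at hzero
    linear_combination hzero
  · rw [← intervalIntegral.integral_sub (hHint _ hbot R) (hHint _ htop R),
      ← intervalIntegral.integral_const_mul, ← intervalIntegral.integral_sub
        (hα.sub hβ).intervalIntegrable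
        ((integrable_one_div_sub_one_div_conj hε).const_mul _).intervalIntegrable]
    refine intervalIntegral.integral_congr fun u _ => ?_
    simp only [Pi.sub_apply]
    rw [hHF _ (hline u _ hbot) (ofReal_add_mul_I_ne_zero (neg_ne_zero.2 hε.ne') u),
      hHF _ (hline u _ htop) (ofReal_add_mul_I_ne_zero hε.ne' u)]
    ring

theorem integral_strip_div_sub_eq_residue {G h : ℂ → ℂ} {ε : ℝ} (hε : 0 < ε) {V : Set ℂ}
    (hVo : IsOpen V) (hV : {z : ℂ | z.im ∈ Icc (-ε) ε} ⊆ V)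
    (hG : DifferentiableOn ℂ G V) (hh : DifferentiableOn ℂ h V) (h_zero : h 0 = 0)
    (h_deriv : deriv h 0 ≠ 0) (h_ne : ∀ p ∈ V, p ≠ 0 → h p ≠ 0)
    (hF : VanishesAtStripEnds (fun p => G p / h p) (-ε) ε)
    (hα : Integrable fun u : ℝ => G (u + (-ε : ℝ) * I) / h (u + (-ε : ℝ) * I))
    (hβ : Integrable fun u : ℝ => G (u + ε * I) / h (u + ε * I)) :
    (∫ u : ℝ, G (u + (-ε : ℝ) * I) / h (u + (-ε : ℝ) * I)) -
      ∫ u : ℝ, G (u + ε * I) / h (u + ε * I) = 2 * π * I * (G 0 / deriv h 0) := by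
  have dslope_eq : ∀ p, p ≠ 0 → dslope h 0 p = h p / p := fun p hp => by
    rw [dslope_of_ne _ hp, slope_def_field, h_zero, sub_zero, sub_zero]
  have dslope_ne : ∀ p ∈ V, dslope h 0 p ≠ 0 := fun p hp => by
    rcases eq_or_ne p 0 with rfl | hp0
    · rwa [dslope_same]
    · rw [dslope_eq p hp0]; exact div_ne_zero (h_ne p hp hp0) hp0
  have hd := (differentiableOn_dslope
    (hVo.mem_nhds (hV (show (0 : ℂ).im ∈ Icc (-ε) ε from ⟨neg_nonpos.2 hε.le, hε.le⟩)))).2 hh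
  rw [integral_strip_sub_eq_two_pi_I_mul hε hVo hV (hG.div hd dslope_ne) (fun p _ hp0 => ?_) hF hα
    hβ, Pi.div_apply, dslope_same]
  rw [Pi.div_apply, dslope_eq p hp0, div_div, div_mul_cancel₀ _ hp0]

/-! ### Integrals against `1 / sin` along lines of direction `e^{-πi/4}` -/

/-- The unit vector `e^{-πi/4}`, the direction in which `e^{-πi x²}` decays fastest. -/
noncomputable def rot : ℂ := exp (-(π * I / 4))

theorem rot_eq : rot = (√2 / 2 : ℝ) - (√2 / 2 : ℝ) * I := by
  rw [rot, show -((π : ℂ) * I / 4) = ((-(π / 4) : ℝ) : ℂ) * I by push_cast; ring, exp_mul_I,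
    ← ofReal_cos, ← ofReal_sin, Real.cos_neg, Real.sin_neg, Real.cos_pi_div_four,
    Real.sin_pi_div_four]
  push_cast; ring

@[simp] theorem rot_re : rot.re = √2 / 2 := by
  simp only [rot_eq, sub_re, re_ofReal_mul, ofReal_re, I_re, mul_zero, sub_zero]

@[simp] theorem rot_im : rot.im = -(√2 / 2) := by
  simp only [rot_eq, sub_im, im_ofReal_mul, ofReal_im, I_im, mul_one, zero_sub]

theorem rot_ne_zero : rot ≠ 0 := exp_ne_zero _

theorem rot_sq : rot ^ 2 = -I := by
  rw [rot, ← Complex.exp_nat_mul,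
    show ((2 : ℕ) : ℂ) * -(π * I / 4) = -(π / 2 * I) by push_cast; ring, Complex.exp_neg,
    exp_pi_div_two_mul_I, inv_I]

@[simp] theorem norm_rot : ‖rot‖ = 1 := by
  rw [rot, show -((π : ℂ) * I / 4) = ((-(π / 4) : ℝ) : ℂ) * I by push_cast; ring]
  exact norm_exp_ofReal_mul_I _

theorem ofReal_add_mul_rot (c v : ℝ) :
    (c : ℂ) + v * rot = rot * (((v + √2 / 2 * c : ℝ) : ℂ) + (√2 / 2 * c : ℝ) * I) := by
  have h2 : ((√2 : ℝ) : ℂ) ^ 2 = 2 := by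
    exact_mod_cast Real.sq_sqrt (show (0 : ℝ) ≤ 2 by norm_num)
  rw [rot_eq]; push_cast
  linear_combination (-(c : ℂ) / 2) * h2 + ((√2 : ℂ) ^ 2 / 4 * c) * I_sq

theorem sq_norm_sin (z : ℂ) : ‖sin z‖ ^ 2 = Real.sin z.re ^ 2 + Real.sinh z.im ^ 2 := by
  rw [Complex.sin_eq, ← ofReal_sin, ← ofReal_cos, ← ofReal_sinh, ← ofReal_cosh, ← normSq_eq_norm_sq,
    normSq_apply]
  simp only [add_re, add_im, mul_re, mul_im, ofReal_re, ofReal_im, I_re, I_im]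
  nlinarith [Real.sin_sq_add_cos_sq z.re, Real.cosh_sq z.im]

theorem sq_norm_cos (z : ℂ) : ‖cos z‖ ^ 2 = Real.cosh z.im ^ 2 - Real.sin z.re ^ 2 := by
  rw [Complex.cos_eq, ← ofReal_sin, ← ofReal_cos, ← ofReal_sinh, ← ofReal_cosh, ← normSq_eq_norm_sq,
    normSq_apply]
  simp only [mul_re, mul_im, sub_re, sub_im, ofReal_re, ofReal_im, I_re, I_im]
  nlinarith [Real.sin_sq_add_cos_sq z.re, Real.cosh_sq z.im]

theorem abs_sinh_im_le_norm_sin (z : ℂ) : |Real.sinh z.im| ≤ ‖sin z‖ := by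
  refine abs_le_of_sq_le_sq ?_ (norm_nonneg _)
  rw [sq_norm_sin]
  exact le_add_of_nonneg_left (sq_nonneg _)

theorem abs_le_abs_sinh (x : ℝ) : |x| ≤ |Real.sinh x| := by
  rw [Real.abs_sinh]; exact Real.self_le_sinh_iff.2 (abs_nonneg x)

theorem half_cosh_le_norm_cos_of_abs_re_le {z : ℂ} (hz : |z.re| ≤ |z.im|) :
    Real.cosh z.im / 2 ≤ ‖cos z‖ := by
  refine le_of_sq_le_sq ?_ (norm_nonneg _)
  have hcosh := Real.cosh_sq z.im
  have him : z.im ^ 2 ≤ Real.sinh z.im ^ 2 := sq_le_sq.2 (abs_le_abs_sinh _)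
  have hsin : Real.sin z.re ^ 2 ≤ z.im ^ 2 := sq_le_sq.2 (Real.abs_sin_le_abs.trans hz)
  rw [sq_norm_cos]
  nlinarith [Real.sin_sq_le_one z.re]

theorem norm_sin_line (N : ℤ) (v : ℝ) :
    ‖sin (π * ((N : ℂ) + 1 / 2 + v * rot))‖ = ‖cos ((π * v : ℝ) * rot)‖ := by
  have hunit : ‖(((N.negOnePow : ℤˣ) : ℤ) : ℂ)‖ = 1 := by
    rcases Int.units_eq_one_or N.negOnePow with h | h <;>
      simp only [h, Units.val_neg, Units.val_one, Int.cast_neg, Int.cast_one, norm_neg, norm_one]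
  rw [show π * ((N : ℂ) + 1 / 2 + v * rot) = (π * v : ℝ) * rot + π / 2 + N * π by push_cast; ring,
    sin_antiperiodic.add_int_mul_eq, Complex.sin_add_pi_div_two, norm_mul, hunit, one_mul]

theorem half_cosh_le_norm_sin_line (N : ℤ) (v : ℝ) :
    Real.cosh (π * (√2 / 2) * v) / 2 ≤ ‖sin (π * ((N : ℂ) + 1 / 2 + v * rot))‖ := by
  rw [norm_sin_line]
  have h := half_cosh_le_norm_cos_of_abs_re_le (z := (π * v : ℝ) * rot) (by
    rw [re_ofReal_mul, im_ofReal_mul, rot_re, rot_im, mul_neg, abs_neg])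
  rwa [im_ofReal_mul, rot_im, mul_neg, Real.cosh_neg, mul_right_comm] at h

theorem half_le_norm_sin_line (N : ℤ) (v : ℝ) :
    1 / 2 ≤ ‖sin (π * ((N : ℂ) + 1 / 2 + v * rot))‖ :=
  le_trans (by linarith [Real.one_le_cosh (π * (√2 / 2) * v)]) (half_cosh_le_norm_sin_line N v)

theorem sin_line_ne_zero (N : ℤ) (v : ℝ) : sin (π * ((N : ℂ) + 1 / 2 + v * rot)) ≠ 0 :=
  norm_pos_iff.1 (one_half_pos.trans_le (half_le_norm_sin_line N v))

theorem one_le_pi_mul_sqrt_two_div_two : 1 ≤ π * (√2 / 2) := by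
  nlinarith [Real.pi_gt_three, Real.one_lt_sqrt_two]

theorem half_le_norm_sin_mul_rot {p : ℂ} (hp : 1 / 2 ≤ |p.im - p.re|) :
    1 / 2 ≤ ‖sin (π * (rot * p))‖ := by
  refine le_trans ?_ ((abs_le_abs_sinh _).trans (abs_sinh_im_le_norm_sin _))
  have him : (π * (rot * p)).im = π * (√2 / 2) * (p.im - p.re) := by
    rw [im_ofReal_mul, mul_im, rot_re, rot_im]; ring
  rw [him, abs_mul, abs_of_pos (by positivity)]
  nlinarith [one_le_pi_mul_sqrt_two_div_two]

theorem sin_mul_rot_ne_zero {p : ℂ} (hp : |p.im| < 1 / 2) (hp0 : p ≠ 0) :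
    sin (π * (rot * p)) ≠ 0 := fun h => by
  obtain ⟨k, hk⟩ := Complex.sin_eq_zero_iff.1 h
  have hmul : rot * p = k := mul_left_cancel₀ (ofReal_ne_zero.2 Real.pi_ne_zero) (by rw [hk]; ring)
  have him : p.im = k * (√2 / 2) := by
    have h3 : -I * p = k * rot := by rw [← rot_sq, ← hmul]; ring
    simpa using congrArg re h3
  have hk0 : k ≠ 0 := fun hk0 => mul_ne_zero rot_ne_zero hp0 (by rw [hmul, hk0, Int.cast_zero])
  have hk1 : (1 : ℝ) ≤ |(k : ℝ)| := by exact_mod_cast Int.one_le_abs hk0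
  rw [him, abs_mul, abs_of_nonneg (by positivity : 0 ≤ √2 / 2)] at hp
  nlinarith [Real.one_lt_sqrt_two]

/-- `∫ Q(x) / (2i sin πx) dx` over the line of direction `e^{-πi/4}` through `c`. -/
noncomputable def lineInt (Q : ℂ → ℂ) (c : ℂ) : ℂ :=
  ∫ v : ℝ, Q (c + v * rot) / (2 * I * sin (π * (c + v * rot))) * rot

theorem integrable_exp_neg_sq : Integrable fun u : ℝ => Real.exp (-u ^ 2) := by
  simpa only [neg_mul, one_mul] using integrable_exp_neg_mul_sq one_pos

/-- The differential `Q(x) dx / (2i sin πx)` in the rotated coordinate `x = e^{-πi/4} p`, where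
lines of direction `e^{-πi/4}` become horizontal. -/
noncomputable def rotIntegrand (Q : ℂ → ℂ) (p : ℂ) : ℂ :=
  Q (rot * p) * rot / (2 * I * sin (π * (rot * p)))

theorem lineInt_ofReal (Q : ℂ → ℂ) (c : ℝ) :
    lineInt Q c = ∫ u : ℝ, rotIntegrand Q (u + (√2 / 2 * c : ℝ) * I) := by
  rw [← integral_add_right_eq_self (fun u : ℝ => rotIntegrand Q (u + (√2 / 2 * c : ℝ) * I))
    (√2 / 2 * c)]
  simp only [lineInt, rotIntegrand, ofReal_add_mul_rot, div_mul_eq_mul_div]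

theorem norm_rotIntegrand_le {Q : ℂ → ℂ} {C : ℝ}
    (hC : ∀ p : ℂ, |p.im| ≤ 1 → ‖Q (rot * p)‖ ≤ C * Real.exp (-p.re ^ 2))
    {u τ : ℝ} (hτ : |τ| ≤ 1) (hs : 1 / 2 ≤ ‖sin (π * (rot * ((u : ℂ) + τ * I)))‖) :
    ‖rotIntegrand Q (u + τ * I)‖ ≤ C * Real.exp (-u ^ 2) := by
  have h := hC (u + τ * I) (by simpa using hτ)
  rw [show ((u : ℂ) + τ * I).re = u by simp] at h
  rw [rotIntegrand, norm_div, norm_mul, norm_mul, norm_mul, norm_rot, mul_one, norm_I,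
    Complex.norm_ofNat, mul_one]
  exact (div_le_self (norm_nonneg _) (by linarith)).trans h

theorem integrable_rotIntegrand {Q : ℂ → ℂ} (hQ : Continuous Q) {C : ℝ}
    (hC : ∀ p : ℂ, |p.im| ≤ 1 → ‖Q (rot * p)‖ ≤ C * Real.exp (-p.re ^ 2))
    {τ : ℝ} (hτ : |τ| ≤ 1) (hs : ∀ u : ℝ, 1 / 2 ≤ ‖sin (π * (rot * ((u : ℂ) + τ * I)))‖) :
    Integrable fun u : ℝ => rotIntegrand Q (u + τ * I) := by
  refine Integrable.mono' (integrable_exp_neg_sq.const_mul C)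
    (Continuous.aestronglyMeasurable ?_) (Eventually.of_forall fun u =>
      norm_rotIntegrand_le hC hτ (hs u))
  refine Continuous.div (by fun_prop) (by fun_prop) fun u => ?_
  exact mul_ne_zero (mul_ne_zero two_ne_zero I_ne_zero)
    (norm_pos_iff.1 (one_half_pos.trans_le (hs u)))

theorem vanishesAtStripEnds_rotIntegrand {Q : ℂ → ℂ} {C : ℝ}
    (hC : ∀ p : ℂ, |p.im| ≤ 1 → ‖Q (rot * p)‖ ≤ C * Real.exp (-p.re ^ 2))
    {ε : ℝ} (hε : ε ≤ 1 / 2) : VanishesAtStripEnds (rotIntegrand Q) (-ε) ε := by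
  refine ⟨fun x => C * Real.exp (-x ^ 2), ?_, fun u τ hu hτ => ?_⟩
  · simpa only [mul_zero, Function.comp_def] using (Real.tendsto_exp_neg_atTop_nhds_zero.comp
      (tendsto_pow_atTop (α := ℝ) two_ne_zero)).const_mul C
  · have hτε : |τ| ≤ ε := abs_le.2 hτ
    have hdist : 1 / 2 ≤ |((u : ℂ) + τ * I).im - ((u : ℂ) + τ * I).re| := by
      rw [show ((u : ℂ) + τ * I).im = τ by simp, show ((u : ℂ) + τ * I).re = u by simp,
        abs_sub_comm]
      linarith [abs_sub_abs_le_abs_sub u τ]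
    simpa only [sq_abs] using norm_rotIntegrand_le hC (by linarith) (half_le_norm_sin_mul_rot hdist)

theorem half_le_norm_sin_mul_rot_of_line {c : ℝ} {N : ℤ} (hc : c = N + 1 / 2) (u : ℝ) :
    1 / 2 ≤ ‖sin (π * (rot * ((u : ℂ) + (√2 / 2 * c : ℝ) * I)))‖ := by
  have h := ofReal_add_mul_rot c (u - √2 / 2 * c)
  rw [sub_add_cancel, hc] at h
  rw [hc, ← h]
  simpa only [ofReal_add, ofReal_intCast, ofReal_div, ofReal_one, ofReal_ofNat]
    using half_le_norm_sin_line N _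

theorem deriv_two_I_mul_sin_mul_rot :
    deriv (fun p : ℂ => 2 * I * sin (π * (rot * p))) 0 = 2 * I * (π * rot) := by
  have h : HasDerivAt (fun p : ℂ => (π : ℂ) * (rot * p)) (π * (rot * 1)) 0 :=
    ((hasDerivAt_id (0 : ℂ)).const_mul rot).const_mul (π : ℂ)
  simpa using (h.csin.const_mul (2 * I)).deriv

/- Between the lines through `-1/2` and `1/2` the only pole is at `0`. -/
theorem lineInt_neg_half_sub_lineInt_half {Q : ℂ → ℂ} (hQ : Differentiable ℂ Q) {C : ℝ}
    (hC : ∀ p : ℂ, |p.im| ≤ 1 → ‖Q (rot * p)‖ ≤ C * Real.exp (-p.re ^ 2)) :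
    lineInt Q (-(1 / 2)) - lineInt Q (1 / 2) = Q 0 := by
  have hsqrt : √2 < 2 := (Real.sqrt_lt' two_pos).2 (by norm_num)
  have hε : √2 / 2 * (1 / 2) < 1 / 2 := by linarith
  have hε0 : 0 < √2 / 2 * (1 / 2) := by positivity
  have hint : ∀ c : ℝ, |√2 / 2 * c| ≤ 1 → ∀ N : ℤ, c = N + 1 / 2 →
      Integrable fun u : ℝ => rotIntegrand Q (u + (√2 / 2 * c : ℝ) * I) := fun c hc N hN =>
    integrable_rotIntegrand hQ.continuous hC hc (half_le_norm_sin_mul_rot_of_line hN)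
  have hneg : √2 / 2 * (-(1 / 2)) = -(√2 / 2 * (1 / 2)) := by ring
  have hpos_le : |√2 / 2 * (1 / 2)| ≤ 1 := by rw [abs_of_pos hε0]; linarith
  have hright := hint (1 / 2) hpos_le 0 (by norm_num)
  have hleft := hint (-(1 / 2)) (by rwa [hneg, abs_neg]) (-1) (by norm_num)
  rw [hneg] at hleft
  have hres := integral_strip_div_sub_eq_residue (G := fun p => Q (rot * p) * rot)
    (h := fun p => 2 * I * sin (π * (rot * p))) hε0 (V := {p : ℂ | |p.im| < 1 / 2})
    (isOpen_lt (by fun_prop) continuous_const)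
    (fun z hz => (abs_le.2 hz).trans_lt hε) (by fun_prop) (by fun_prop)
    (by rw [mul_zero, mul_zero, Complex.sin_zero, mul_zero])
    (by
      rw [deriv_two_I_mul_sin_mul_rot]
      exact mul_ne_zero (mul_ne_zero two_ne_zero I_ne_zero)
        (mul_ne_zero (ofReal_ne_zero.2 Real.pi_ne_zero) rot_ne_zero))
    (fun p hp hp0 => mul_ne_zero (mul_ne_zero two_ne_zero I_ne_zero) (sin_mul_rot_ne_zero hp hp0))
    (vanishesAtStripEnds_rotIntegrand hC hε.le) hleft hright
  have hlineR := lineInt_ofReal Q (1 / 2)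
  have hlineL := lineInt_ofReal Q (-(1 / 2))
  rw [hneg] at hlineL
  push_cast at hlineL hlineR
  rw [hlineL, hlineR]
  simp only [rotIntegrand]
  push_cast at hres
  rw [hres, deriv_two_I_mul_sin_mul_rot, mul_zero]
  have := rot_ne_zero
  have : (π : ℂ) ≠ 0 := ofReal_ne_zero.2 Real.pi_ne_zero
  field_simp [I_ne_zero]

/-! ### Mordell's integral -/

/-- The Gaussian `e^{-πi a x² + 2πi b x}`. -/
noncomputable def quad (a : ℝ) (b x : ℂ) : ℂ := exp (-(π * I * a * x ^ 2) + 2 * π * I * b * x)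

theorem differentiable_quad (a : ℝ) (b : ℂ) : Differentiable ℂ (quad a b) := by
  unfold quad; fun_prop

theorem quad_zero (a : ℝ) (b : ℂ) : quad a b 0 = 1 := by
  rw [quad, mul_zero, add_zero, zero_pow two_ne_zero, mul_zero, neg_zero, Complex.exp_zero]

theorem quad_add (a : ℝ) (b z x : ℂ) : quad a b (z + x) = quad a b z * quad a (b - a * z) x := by
  simp only [quad, ← Complex.exp_add]
  ring_nf

theorem quad_add_param (a : ℝ) (b c x : ℂ) :
    quad a (b + c) x = quad a b x * exp (2 * π * I * c * x) := by
  simp only [quad, ← Complex.exp_add]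
  ring_nf

theorem exp_sub_exp_neg (x : ℂ) : exp (π * I * x) - exp (-(π * I * x)) = 2 * I * sin (π * x) := by
  rw [show (π : ℂ) * I * x = (π * x) * I by ring, ← neg_mul, exp_mul_I, exp_mul_I, Complex.cos_neg,
    Complex.sin_neg]
  ring

theorem quad_sub_quad_sub_one (a : ℝ) (b x : ℂ) :
    quad a b x - quad a (b - 1) x = 2 * I * sin (π * x) * quad a (b - 1 / 2) x := by
  have h₁ := quad_add_param a (b - 1 / 2) (1 / 2) x
  have h₂ := quad_add_param a (b - 1 / 2) (-(1 / 2)) x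
  rw [show 2 * (π : ℂ) * I * (1 / 2) * x = π * I * x by ring, sub_add_cancel] at h₁
  rw [show 2 * (π : ℂ) * I * -(1 / 2) * x = -(π * I * x) by ring,
    show b - 1 / 2 + -(1 / 2) = b - 1 by ring] at h₂
  rw [h₁, h₂, ← exp_sub_exp_neg]
  ring

theorem quad_natCast_one (b : ℂ) (n : ℕ) :
    quad 1 b n = (-1) ^ n * exp (2 * π * I * n * b) := by
  rw [← exp_pi_mul_I, ← Complex.exp_nat_mul, ← Complex.exp_add, quad,
    Complex.exp_eq_exp_iff_exists_int]
  obtain ⟨k, hk⟩ := Int.even_mul_succ_self (n : ℤ)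
  refine ⟨-k, ?_⟩
  have hkℂ : (n : ℂ) * (n + 1) = k + k := by exact_mod_cast congrArg (Int.cast : ℤ → ℂ) hk
  push_cast
  linear_combination (-(π * I)) * hkℂ

theorem norm_quad_mul_rot (a : ℝ) (b p : ℂ) :
    ‖quad a b (rot * p)‖ =
      Real.exp (-(π * a) * (p.re ^ 2 - p.im ^ 2) + (2 * π * I * b * (rot * p)).re) := by
  have hsq : -(π * I * a * (rot * p) ^ 2) = ((-(π * a) : ℝ) : ℂ) * p ^ 2 := by
    rw [mul_pow, rot_sq]; push_cast
    linear_combination (π * a * p ^ 2) * I_sq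
  rw [quad, norm_exp, hsq, add_re, re_ofReal_mul, show (p ^ 2).re = p.re ^ 2 - p.im ^ 2 by
    rw [sq, mul_re]; ring]

theorem exists_norm_quad_mul_rot_le {a : ℝ} (ha : 1 ≤ a) (b : ℂ) :
    ∃ C : ℝ, ∀ p : ℂ, |p.im| ≤ 1 → ‖quad a b (rot * p)‖ ≤ C * Real.exp (-p.re ^ 2) := by
  set M := 2 * π * ‖b‖ with hM
  refine ⟨Real.exp (π * a + M + M ^ 2 / 4), fun p hp => ?_⟩
  rw [norm_quad_mul_rot, ← Real.exp_add, Real.exp_le_exp]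
  have hlinear : (2 * π * I * b * (rot * p)).re ≤ M * (|p.re| + 1) := by
    refine (re_le_norm _).trans ?_
    have hnorm : ‖2 * (π : ℂ) * I * b * (rot * p)‖ = M * ‖p‖ := by
      simp only [norm_mul, norm_rot, norm_I, Complex.norm_ofNat, Complex.norm_real,
        Real.norm_eq_abs, abs_of_pos Real.pi_pos, hM]
      ring
    rw [hnorm]
    gcongr
    linarith [norm_le_abs_re_add_abs_im p]
  have him : π * a * p.im ^ 2 ≤ π * a :=
    mul_le_of_le_one_right (by positivity) (sq_le_one_iff_abs_le_one _ |>.2 hp)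
  have hre : 2 * p.re ^ 2 ≤ π * a * p.re ^ 2 := by
    have : 2 ≤ π * a := by nlinarith [Real.pi_gt_three]
    gcongr
  have hamgm : M * |p.re| ≤ p.re ^ 2 + M ^ 2 / 4 := by
    rw [← sq_abs p.re]; linarith [sq_nonneg (|p.re| - M / 2)]
  linarith

theorem exists_norm_quad_line_le {a : ℝ} (ha : 1 ≤ a) (b c : ℂ) :
    ∃ C : ℝ, ∀ v : ℝ, ‖quad a b (c + v * rot)‖ ≤ C * Real.exp (-v ^ 2) := by
  obtain ⟨C, hC⟩ := exists_norm_quad_mul_rot_le ha (b - a * c)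
  refine ⟨‖quad a b c‖ * C, fun v => ?_⟩
  rw [quad_add, norm_mul, mul_assoc, mul_comm (v : ℂ)]
  have h := hC v (by rw [ofReal_im, abs_zero]; exact zero_le_one)
  rw [ofReal_re] at h
  gcongr

theorem integrable_quad_div_sin_line {a : ℝ} (ha : 1 ≤ a) (b : ℂ) (N : ℤ) :
    Integrable fun v : ℝ => quad a b (N + 1 / 2 + v * rot) /
      (2 * I * sin (π * (N + 1 / 2 + v * rot))) * rot := by
  obtain ⟨C, hC⟩ := exists_norm_quad_line_le ha b (N + 1 / 2)
  have hcont := (differentiable_quad a b).continuous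
  refine (Integrable.mono' (integrable_exp_neg_sq.const_mul C)
    (Continuous.aestronglyMeasurable ?_) (Eventually.of_forall fun v => ?_)).mul_const _
  · exact Continuous.div (by fun_prop) (by fun_prop) fun v =>
      mul_ne_zero (mul_ne_zero two_ne_zero I_ne_zero) (sin_line_ne_zero N v)
  · rw [norm_div, norm_mul, norm_mul, norm_I, Complex.norm_ofNat, mul_one]
    refine (div_le_self (norm_nonneg _) ?_).trans (hC v)
    linarith [half_le_norm_sin_line N v]

theorem integral_quad_line {a : ℝ} (ha : 0 < a) (b c : ℂ) :
    ∫ v : ℝ, quad a b (c + v * rot) * rot =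
      rot * (1 / a) ^ (1 / 2 : ℂ) * exp (π * I * b ^ 2 / a) := by
  have hπ0 : (π : ℂ) ≠ 0 := ofReal_ne_zero.2 Real.pi_ne_zero
  have ha0 : (a : ℂ) ≠ 0 := ofReal_ne_zero.2 ha.ne'
  have hdecay : (-(π * a) : ℂ).re < 0 := by
    rw [neg_re, ← ofReal_mul, ofReal_re]
    exact neg_neg_of_pos (mul_pos Real.pi_pos ha)
  have hgauss := integral_cexp_quadratic hdecay (rot * (2 * π * I * (b - a * c)))
    (-(π * I * a * c ^ 2) + 2 * π * I * b * c)
  have hexpand : ∀ v : ℝ, quad a b (c + v * rot) = exp (-(π * a) * (v : ℂ) ^ 2 +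
      rot * (2 * π * I * (b - a * c)) * v + (-(π * I * a * c ^ 2) + 2 * π * I * b * c)) := by
    intro v
    unfold quad
    congr 1
    linear_combination (-(π * I * a * (v : ℂ) ^ 2)) * rot_sq + π * a * (v : ℂ) ^ 2 * I_sq
  have hexponent : -(π * I * a * c ^ 2) + 2 * π * I * b * c -
      (rot * (2 * π * I * (b - a * c))) ^ 2 / (4 * -(π * a)) = π * I * b ^ 2 / a := by
    rw [mul_pow, rot_sq, show (2 * π * I * (b - a * c)) ^ 2 = -(4 * π ^ 2 * (b - a * c) ^ 2) by
      linear_combination 4 * π ^ 2 * (b - a * c) ^ 2 * I_sq]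
    field_simp
    ring
  rw [integral_mul_const]
  simp only [hexpand]
  rw [hgauss, neg_neg, show (π : ℂ) / (π * a) = 1 / a by field_simp, hexponent]
  ring

theorem lineInt_natCast_add (Q : ℂ → ℂ) (n : ℕ) (c : ℂ) :
    lineInt Q (n + c) = (-1) ^ n * lineInt (fun x => Q (n + x)) c := by
  have hsin : ∀ x : ℂ, sin (π * (n + x)) = (-1) ^ n * sin (π * x) := fun x => by
    rw [show (π : ℂ) * (n + x) = π * x + n * π by ring]
    exact sin_antiperiodic.add_nat_mul_eq n
  have hinv : ((-1 : ℂ) ^ n)⁻¹ = (-1) ^ n := by rw [← inv_pow, inv_neg_one]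
  simp only [lineInt]
  rw [← integral_const_mul]
  congr 1; ext v
  rw [add_assoc, hsin, mul_left_comm, div_mul_eq_div_div, div_eq_mul_inv _ ((-1 : ℂ) ^ n), hinv]
  ring

theorem lineInt_const_mul (k : ℂ) (Q : ℂ → ℂ) (c : ℂ) :
    lineInt (fun x => k * Q x) c = k * lineInt Q c := by
  simp only [lineInt, ← integral_const_mul, mul_div_assoc, mul_assoc]

theorem lineInt_quad_natCast_add (a : ℝ) (b : ℂ) (n : ℕ) (c : ℂ) :
    lineInt (quad a b) (n + c) = (-1) ^ n * quad a b n * lineInt (quad a (b - a * n)) c := by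
  simp only [lineInt_natCast_add, quad_add, lineInt_const_mul, mul_assoc]

theorem lineInt_quad_sub_lineInt_quad_succ {a : ℝ} (ha : 1 ≤ a) (b : ℂ) (n : ℕ) :
    lineInt (quad a b) (n - 1 / 2) - lineInt (quad a b) (n + 1 / 2) = (-1) ^ n * quad a b n := by
  obtain ⟨C, hC⟩ := exists_norm_quad_mul_rot_le ha (b - a * n)
  rw [sub_eq_add_neg (n : ℂ), lineInt_quad_natCast_add, lineInt_quad_natCast_add, ← mul_sub,
    lineInt_neg_half_sub_lineInt_half (differentiable_quad _ _) hC, quad_zero, mul_one]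

theorem lineInt_quad_sub_lineInt_quad_sub_one {a : ℝ} (ha : 1 ≤ a) (b : ℂ) (N : ℤ) :
    lineInt (quad a b) (N + 1 / 2) - lineInt (quad a (b - 1)) (N + 1 / 2) =
      rot * (1 / a) ^ (1 / 2 : ℂ) * exp (π * I * (b - 1 / 2) ^ 2 / a) := by
  rw [← integral_quad_line (one_pos.trans_le ha) _ (N + 1 / 2), lineInt, lineInt,
    ← integral_sub (integrable_quad_div_sin_line ha b N)
      (integrable_quad_div_sin_line ha (b - 1) N)]
  congr 1; ext v
  rw [← sub_mul, ← sub_div, quad_sub_quad_sub_one, mul_div_cancel_left₀ _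
    (mul_ne_zero (mul_ne_zero two_ne_zero I_ne_zero) (sin_line_ne_zero N v))]

theorem lineInt_quad_add_one (a : ℝ) (b c : ℂ) :
    lineInt (quad a b) (c + 1) = -quad a b 1 * lineInt (quad a (b - a)) c := by
  rw [add_comm]
  simpa only [Nat.cast_one, pow_one, neg_one_mul, mul_one] using lineInt_quad_natCast_add a b 1 c

theorem lineInt_quad_one_add_one (b : ℂ) (N : ℤ) :
    lineInt (quad 1 b) (N + 1 / 2 + 1) =
      exp (2 * π * I * b) *
        (lineInt (quad 1 b) (N + 1 / 2) - rot * exp (π * I * (b - 1 / 2) ^ 2)) := by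
  have h := lineInt_quad_sub_lineInt_quad_sub_one le_rfl b N
  have hq := quad_natCast_one b 1
  simp only [Nat.cast_one, pow_one, neg_one_mul, mul_one] at hq
  rw [ofReal_one, div_one, div_one, one_cpow, mul_one] at h
  rw [lineInt_quad_add_one, hq, ofReal_one]
  linear_combination (-exp (2 * π * I * b)) * h

theorem lineInt_quad_two_add_one (b : ℂ) (N : ℤ) :
    lineInt (quad 2 b) (N + 1 / 2 + 1) =
      -exp (2 * π * I * b) * (lineInt (quad 2 b) (N + 1 / 2) -
        rot * (1 / 2) ^ (1 / 2 : ℂ) *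
          (exp (π * I * (b - 1 / 2) ^ 2 / 2) + exp (π * I * (b - 3 / 2) ^ 2 / 2))) := by
  have h₁ := lineInt_quad_sub_lineInt_quad_sub_one one_le_two b N
  have h₂ := lineInt_quad_sub_lineInt_quad_sub_one one_le_two (b - 1) N
  have hq : quad 2 b 1 = exp (2 * π * I * b) := by
    refine Complex.exp_eq_exp_iff_exists_int.2 ⟨-1, ?_⟩
    push_cast; ring
  rw [show b - 1 - 1 = b - 2 by ring, show b - 1 - 1 / 2 = b - 3 / 2 by ring] at h₂
  rw [ofReal_ofNat] at h₁ h₂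
  rw [lineInt_quad_add_one, hq, ofReal_ofNat]
  linear_combination exp (2 * π * I * b) * (h₁ + h₂)

theorem norm_exp_two_pi_I_mul_lt_one {y : ℂ} (hy : 0 < y.im) : ‖exp (2 * π * I * y)‖ < 1 := by
  rw [norm_exp, Real.exp_lt_one_iff, show (2 * π * I * y).re = -(2 * π * y.im) by simp]
  exact neg_neg_of_pos (mul_pos Real.two_pi_pos hy)

theorem hasSum_exp_tail {y : ℂ} (hy : 0 < y.im) (N : ℕ) :
    HasSum (fun k : ℕ => exp (2 * π * I * ((N + 1 + k : ℕ) : ℂ) * y))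
      (exp (2 * π * I * (N + 1) * y) / (1 - exp (2 * π * I * y))) := by
  have h := (hasSum_geometric_of_norm_lt_one (norm_exp_two_pi_I_mul_lt_one hy)).mul_left
    (exp (2 * π * I * (N + 1) * y))
  rw [← div_eq_mul_inv] at h
  refine h.congr_fun fun k => ?_
  rw [← Complex.exp_nat_mul, ← Complex.exp_add]
  congr 1; push_cast; ring

theorem one_sub_exp_two_pi_I_mul (y : ℂ) :
    1 - exp (2 * π * I * y) = -(2 * I * sin (π * y)) * exp (π * I * y) := by
  rw [← exp_sub_exp_neg, neg_sub, sub_mul, ← Complex.exp_add, ← Complex.exp_add, neg_add_cancel,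
    Complex.exp_zero]
  ring_nf

/- Mordell: both `x ↦ x + 1` and the residue theorem relate the integrals over neighbouring lines,
and eliminating one of them evaluates the other. -/
theorem exp_div_sin_eq_lineInt_sub_tsum {y : ℂ} (hy : 0 < y.im) (N : ℕ) :
    exp (π * I * y ^ 2) / (2 * I * sin (π * y)) =
      lineInt (quad 1 y) (N + 1 / 2) - ∑' k : ℕ, exp (2 * π * I * ((N + 1 + k : ℕ) : ℂ) * y) := by
  have hresidue := lineInt_quad_sub_lineInt_quad_succ le_rfl y (N + 1)
  have hshift := lineInt_quad_one_add_one y N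
  rw [quad_natCast_one, ← mul_assoc, ← mul_pow, neg_one_mul, neg_neg, one_pow, one_mul,
    show ((N + 1 : ℕ) : ℂ) - 1 / 2 = N + 1 / 2 by push_cast; ring,
    show ((N + 1 : ℕ) : ℂ) + 1 / 2 = N + 1 / 2 + 1 by push_cast; ring, Nat.cast_add_one]
    at hresidue
  rw [Int.cast_natCast] at hshift
  rw [hshift] at hresidue
  have hgauss : exp (2 * π * I * y) * (rot * exp (π * I * (y - 1 / 2) ^ 2)) =
      exp (π * I * y ^ 2) * exp (π * I * y) := by
    simp only [rot, ← Complex.exp_add]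
    ring_nf
  have hne : 1 - exp (2 * π * I * y) ≠ 0 := fun h => by
    have hlt := norm_exp_two_pi_I_mul_lt_one hy
    rw [← sub_eq_zero.1 h, norm_one] at hlt
    exact lt_irrefl _ hlt
  have hfac := one_sub_exp_two_pi_I_mul y
  have hs : 2 * I * sin (π * y) ≠ 0 := fun h => hne (by rw [hfac, h, neg_zero, zero_mul])
  rw [(hasSum_exp_tail hy N).tsum_eq, eq_sub_iff_add_eq, div_add_div _ _ hs hne,
    div_eq_iff (mul_ne_zero hs hne)]
  linear_combination (-(2 * I * sin (π * y))) * hresidue + (2 * I * sin (π * y)) * hgauss +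
    exp (π * I * y ^ 2) * hfac

theorem half_cpow_half : (1 / 2 : ℂ) ^ (1 / 2 : ℂ) = ((√2 : ℝ) : ℂ) / 2 := by
  have hreal : ((1 / 2 : ℝ) ^ (1 / 2 : ℝ) : ℝ) = √2 / 2 := by
    rw [← Real.sqrt_eq_rpow, Real.sqrt_eq_iff_mul_self_eq (by norm_num) (by positivity)]
    linarith [Real.mul_self_sqrt (show (0 : ℝ) ≤ 2 by norm_num)]
  have hcast := Complex.ofReal_cpow (show (0 : ℝ) ≤ 1 / 2 by norm_num) (1 / 2)
  rw [hreal] at hcast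
  push_cast at hcast
  exact hcast.symm

/-- The Gaussian `e^{-2πi (x - η)²}` that approximates the integrand near the saddle point `η`. -/
noncomputable def saddleGauss (η x : ℂ) : ℂ := exp (-(2 * π * I * (x - η) ^ 2))

theorem saddleGauss_eq_mul_quad (η x : ℂ) :
    saddleGauss η x = exp (-(2 * π * I * η ^ 2)) * quad 2 (2 * η) x := by
  rw [saddleGauss, quad, ← Complex.exp_add]; congr 1; push_cast; ring

theorem saddleGauss_natCast (η : ℂ) (n : ℕ) :
    saddleGauss η n = exp (-(2 * π * I * η ^ 2)) * exp (4 * π * I * η) ^ n := by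
  rw [saddleGauss, ← Complex.exp_nat_mul, ← Complex.exp_add]
  refine Complex.exp_eq_exp_iff_exists_int.2 ⟨-(n ^ 2 : ℤ), ?_⟩
  push_cast; ring

theorem norm_exp_four_pi_I_mul_lt_one {η : ℂ} (hη : 0 < η.im) : ‖exp (4 * π * I * η)‖ < 1 := by
  rw [show 4 * π * I * η = 2 * π * I * (2 * η) by ring]
  exact norm_exp_two_pi_I_mul_lt_one (by simpa using hη)

theorem one_add_exp_four_pi_I_mul_ne_zero {η : ℂ} (hη : 0 < η.im) :
    1 + exp (4 * π * I * η) ≠ 0 := fun h => by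
  have hlt := norm_exp_four_pi_I_mul_lt_one hη
  rw [← neg_eq_of_add_eq_zero_right h, norm_neg, norm_one] at hlt
  exact lt_irrefl _ hlt

theorem one_add_exp_four_pi_I_mul (η : ℂ) :
    1 + exp (4 * π * I * η) = exp (2 * π * I * η) * (2 * cos (2 * π * η)) := by
  rw [Complex.cos, mul_div_cancel₀ _ (two_ne_zero' ℂ), mul_add, ← Complex.exp_add,
    ← Complex.exp_add, add_comm, show 2 * π * I * η + -(2 * π * η) * I = 0 by ring,
    Complex.exp_zero]
  congr 2; ring

theorem hasSum_saddleGauss {η : ℂ} (hη : 0 < η.im) (N : ℕ) :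
    HasSum (fun k : ℕ => (-1) ^ (N + 1 + k) * saddleGauss η ((N + 1 + k : ℕ) : ℂ))
      ((-1) ^ (N + 1) * saddleGauss η ((N + 1 : ℕ) : ℂ) / (1 + exp (4 * π * I * η))) := by
  have h := (hasSum_geometric_of_norm_lt_one (ξ := -exp (4 * π * I * η))
    (by rw [norm_neg]; exact norm_exp_four_pi_I_mul_lt_one hη)).mul_left
    ((-1) ^ (N + 1) * saddleGauss η ((N + 1 : ℕ) : ℂ))
  rw [← div_eq_mul_inv, sub_neg_eq_add] at h
  refine h.congr_fun fun k => ?_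
  rw [saddleGauss_natCast, saddleGauss_natCast, neg_pow (exp (4 * π * I * η)) k]
  ring

theorem two_mul_sin_pi_mul (η : ℂ) :
    2 * sin (π * η) = exp (π * I * η + -π / 2 * I) - exp (-(π * I * η) + -π / 2 * I) := by
  rw [Complex.exp_add, Complex.exp_add, exp_neg_pi_div_two_mul_I, ← sub_mul, exp_sub_exp_neg]
  linear_combination (2 * sin (π * η)) * I_sq

theorem exp_mul_rot_mul_exp_add_exp (η : ℂ) :
    exp (-(2 * π * I * η ^ 2)) * (rot * (exp (π * I * (2 * η - 1 / 2) ^ 2 / 2) +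
      exp (π * I * (2 * η - 3 / 2) ^ 2 / 2))) =
      exp (-(2 * π * I * η)) * exp (3 * π * I / 8) * (2 * sin (π * η)) := by
  have hneg : exp (π * I * (2 * η - 3 / 2) ^ 2 / 2) =
      -exp (π * I * (2 * η ^ 2 - 3 * η + 1 / 8)) := by
    rw [show (π : ℂ) * I * (2 * η - 3 / 2) ^ 2 / 2 =
      π * I * (2 * η ^ 2 - 3 * η + 1 / 8) + π * I by ring, Complex.exp_add, exp_pi_mul_I]
    ring
  rw [hneg, two_mul_sin_pi_mul, rot, ← sub_eq_add_neg, mul_sub, mul_sub, mul_sub]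
  simp only [← Complex.exp_add]
  congr 2 <;> ring

/- The same elimination as in `exp_div_sin_eq_lineInt_sub_tsum`, now with the residue at `N + 1`
and the shift for the Gaussian `e^{-2πi x² + 4πi η x}`. -/
theorem saddleGauss_natCast_sub_mul_lineInt (η : ℂ) (N : ℕ) :
    (-1) ^ (N + 1) * saddleGauss η ((N + 1 : ℕ) : ℂ) -
      (1 + exp (4 * π * I * η)) * lineInt (saddleGauss η) (N + 1 / 2) =
      -((√2 : ℂ) * exp (3 * π * I / 8) * sin (π * η)) * exp (2 * π * I * η) := by
  have hresidue := lineInt_quad_sub_lineInt_quad_succ one_le_two (2 * η) (N + 1)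
  have hshift := lineInt_quad_two_add_one (2 * η) N
  rw [Int.cast_natCast] at hshift
  rw [show ((N + 1 : ℕ) : ℂ) - 1 / 2 = N + 1 / 2 by push_cast; ring,
    show ((N + 1 : ℕ) : ℂ) + 1 / 2 = N + 1 / 2 + 1 by push_cast; ring, hshift, half_cpow_half,
    show 2 * π * I * (2 * η) = 4 * π * I * η by ring] at hresidue
  have hexp : exp (4 * π * I * η) * exp (-(2 * π * I * η)) = exp (2 * π * I * η) := by
    rw [← Complex.exp_add]; congr 1; ring
  rw [saddleGauss_eq_mul_quad, funext (saddleGauss_eq_mul_quad η), lineInt_const_mul]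
  linear_combination (-exp (-(2 * π * I * η ^ 2))) * hresidue -
    exp (4 * π * I * η) * ((√2 : ℂ) / 2) * exp_mul_rot_mul_exp_add_exp η -
    ((√2 : ℂ) * exp (3 * π * I / 8) * sin (π * η)) * hexp

theorem cos_two_pi_mul_ne_zero {η : ℂ} (hη : 0 < η.im) : cos (2 * π * η) ≠ 0 := fun h =>
  one_add_exp_four_pi_I_mul_ne_zero hη (by rw [one_add_exp_four_pi_I_mul, h, mul_zero, mul_zero])

/-- The factor by which the saddle point contributes to `mainTerm`: up to sign, the sum of
`saddleGauss η` over the integers to the right of the line minus its integral along the line. -/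
noncomputable def saddleValue (η : ℂ) : ℂ :=
  (√2 : ℂ) * exp (3 * π * I / 8) * sin (π * η) / (2 * cos (2 * π * η))

theorem tsum_saddleGauss_sub_lineInt {η : ℂ} (hη : 0 < η.im) (N : ℕ) :
    (∑' k : ℕ, (-1) ^ (N + 1 + k) * saddleGauss η ((N + 1 + k : ℕ) : ℂ)) -
      lineInt (saddleGauss η) (N + 1 / 2) = -saddleValue η := by
  rw [(hasSum_saddleGauss hη N).tsum_eq, div_sub' (one_add_exp_four_pi_I_mul_ne_zero hη),
    saddleGauss_natCast_sub_mul_lineInt, one_add_exp_four_pi_I_mul, saddleValue]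
  field_simp [Complex.exp_ne_zero]

theorem integrableOn_rpow_mul_exp_neg {q m : ℝ} (hq : -1 < q) (hm : 0 < m) :
    IntegrableOn (fun t : ℝ => t ^ q * Real.exp (-(m * t))) (Ioi 0) := by
  simpa only [Real.rpow_one, neg_mul] using integrableOn_rpow_mul_exp_neg_mul_rpow hq one_pos hm

theorem norm_cpow_mul_exp_neg (a r : ℂ) {t : ℝ} (ht : 0 < t) :
    ‖(t : ℂ) ^ a * exp (-(r * t))‖ = t ^ a.re * Real.exp (-(r.re * t)) := by
  rw [norm_mul, norm_cpow_eq_rpow_re_of_pos ht, norm_exp, neg_re, re_mul_ofReal]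

theorem aestronglyMeasurable_cpow_mul_exp_neg (a r : ℂ) :
    AEStronglyMeasurable (fun t : ℝ => (t : ℂ) ^ a * exp (-(r * t)))
      (volume.restrict (Ioi 0)) :=
  ContinuousOn.aestronglyMeasurable (fun _ ht => ContinuousAt.continuousWithinAt <|
    (continuousAt_ofReal_cpow_const _ _ (Or.inr (ne_of_gt ht))).mul (by fun_prop))
    measurableSet_Ioi

theorem integrableOn_cpow_mul_exp_neg {a r : ℂ} (ha : -1 < a.re) (hr : 0 < r.re) :
    IntegrableOn (fun t : ℝ => (t : ℂ) ^ a * exp (-(r * t))) (Ioi 0) := by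
  refine Integrable.mono' (integrableOn_rpow_mul_exp_neg ha hr)
    (aestronglyMeasurable_cpow_mul_exp_neg a r) ?_
  filter_upwards [ae_restrict_mem measurableSet_Ioi] with t ht
  rw [norm_cpow_mul_exp_neg a r ht]

theorem differentiableAt_integral_cpow_mul_exp_neg {a r : ℂ} (ha : -1 < a.re) (hr : 0 < r.re) :
    DifferentiableAt ℂ (fun r : ℂ => ∫ t in Ioi (0 : ℝ), (t : ℂ) ^ a * exp (-(r * t))) r := by
  have hnear : {z : ℂ | r.re / 2 < z.re} ∈ 𝓝 r :=
    (isOpen_lt continuous_const continuous_re).mem_nhds (half_lt_self hr)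
  refine (hasDerivAt_integral_of_dominated_loc_of_deriv_le (μ := volume.restrict (Ioi (0 : ℝ)))
    (F := fun (r : ℂ) (t : ℝ) => (t : ℂ) ^ a * exp (-(r * t)))
    (F' := fun (r : ℂ) (t : ℝ) => (t : ℂ) ^ a * (exp (-(r * t)) * -(t : ℂ)))
    (bound := fun t => t ^ (a.re + 1) * Real.exp (-(r.re / 2 * t))) hnear
    (Eventually.of_forall fun z => aestronglyMeasurable_cpow_mul_exp_neg a z)
    (integrableOn_cpow_mul_exp_neg ha hr) ?_ ?_
    (integrableOn_rpow_mul_exp_neg (by linarith) (half_pos hr)) ?_).2.differentiableAt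
  · simp only [← mul_assoc]
    exact (aestronglyMeasurable_cpow_mul_exp_neg a r).mul
      (Continuous.aestronglyMeasurable (show Continuous fun t : ℝ => -(t : ℂ) by fun_prop))
  · filter_upwards [ae_restrict_mem measurableSet_Ioi] with t (ht : 0 < t) z (hz : r.re / 2 < z.re)
    rw [← mul_assoc, norm_mul, norm_cpow_mul_exp_neg a z ht, norm_neg, Complex.norm_of_nonneg ht.le,
      Real.rpow_add_one ht.ne', mul_right_comm]
    gcongr
  · refine Eventually.of_forall fun t z _ => ?_
    have h : HasDerivAt (fun z : ℂ => -(z * t)) (-(1 * (t : ℂ))) z :=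
      ((hasDerivAt_id z).mul_const (t : ℂ)).neg
    simpa only [one_mul] using h.cexp.const_mul ((t : ℂ) ^ a)

theorem differentiableAt_one_div_cpow_const (a : ℂ) {r : ℂ} (hr : 0 < r.re) :
    DifferentiableAt ℂ (fun r : ℂ => (1 / r) ^ a) r := by
  have hr0 : r ≠ 0 := fun h => hr.ne' (by rw [h, zero_re])
  refine ((differentiableAt_const _).div differentiableAt_id hr0).cpow_const (Or.inl ?_)
  rw [Pi.div_apply, one_div, inv_re]
  exact div_pos hr (normSq_pos.2 hr0)

theorem tendsto_ofReal_nhdsNE (x : ℝ) : Tendsto ((↑) : ℝ → ℂ) (𝓝[≠] x) (𝓝[≠] (x : ℂ)) :=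
  continuous_ofReal.continuousWithinAt.tendsto_nhdsWithin fun _ hy => ofReal_injective.ne hy

/- Both sides are holomorphic in the half-plane `0 < Re r` and agree for real `r`, where the
identity is `Complex.integral_cpow_mul_exp_neg_mul_Ioi`. -/
theorem integral_cpow_mul_exp_neg_mul_Ioi_of_re_pos {a r : ℂ} (ha : 0 < a.re) (hr : 0 < r.re) :
    ∫ t in Ioi (0 : ℝ), (t : ℂ) ^ (a - 1) * exp (-(r * t)) = (1 / r) ^ a * Gamma a := by
  have hopen : IsOpen {z : ℂ | 0 < z.re} := isOpen_lt continuous_const continuous_re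
  have hlaplace : AnalyticOnNhd ℂ
      (fun r : ℂ => ∫ t in Ioi (0 : ℝ), (t : ℂ) ^ (a - 1) * exp (-(r * t))) {z | 0 < z.re} :=
    DifferentiableOn.analyticOnNhd (fun z hz => (differentiableAt_integral_cpow_mul_exp_neg
      (by simpa using ha) hz).differentiableWithinAt) hopen
  have hpower : AnalyticOnNhd ℂ (fun r : ℂ => (1 / r) ^ a * Gamma a) {z | 0 < z.re} :=
    DifferentiableOn.analyticOnNhd (fun z hz =>
      ((differentiableAt_one_div_cpow_const a hz).mul_const _).differentiableWithinAt) hopen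
  refine hlaplace.eqOn_of_preconnected_of_frequently_eq hpower
    (convex_halfSpace_re_gt 0).isPreconnected (z₀ := ((1 : ℝ) : ℂ)) (zero_lt_one' ℝ)
    ((tendsto_ofReal_nhdsNE 1).frequently (Eventually.frequently ?_)) hr
  filter_upwards [(lt_mem_nhds one_pos).filter_mono nhdsWithin_le_nhds] with x hx
  exact integral_cpow_mul_exp_neg_mul_Ioi ha hx

/-! ### The path of integration through `0` -/

/-- The direction `e^{-3πi/4}` of the path of integration of `auxR`. -/
noncomputable def dir : ℂ := exp (-(3 * π * I / 4))

theorem dir_eq_neg_conj_rot : dir = -conj rot := by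
  rw [dir, rot, ← exp_conj, show -(3 * (π : ℂ) * I / 4) = π / 4 * I - π * I by ring,
    exp_sub_pi_mul_I]
  simp only [map_neg, map_div₀, map_mul, conj_ofReal, conj_I, map_ofNat, mul_neg, neg_div, neg_neg]
  ring_nf

theorem dir_sq : dir ^ 2 = I := by
  rw [dir_eq_neg_conj_rot, neg_sq, ← map_pow, rot_sq, map_neg, conj_I, neg_neg]

theorem dir_ne_zero : dir ≠ 0 := exp_ne_zero _

@[simp] theorem norm_dir : ‖dir‖ = 1 := by
  rw [dir_eq_neg_conj_rot, norm_neg, norm_conj, norm_rot]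

theorem dir_mul_re (p : ℂ) : (dir * p).re = √2 / 2 * (p.im - p.re) := by
  rw [dir_eq_neg_conj_rot, mul_re, neg_re, neg_im, conj_re, conj_im, rot_re, rot_im]; ring

theorem dir_mul_im (p : ℂ) : (dir * p).im = -(√2 / 2 * (p.re + p.im)) := by
  rw [dir_eq_neg_conj_rot, mul_im, neg_re, neg_im, conj_re, conj_im, rot_re, rot_im]; ring

theorem ofReal_add_mul_dir (c u : ℝ) :
    (c : ℂ) + u * dir = dir * (((u - √2 / 2 * c : ℝ) : ℂ) + (√2 / 2 * c : ℝ) * I) := by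
  have hneg : -conj ((c : ℂ) + ((-u : ℝ) : ℂ) * rot) = -(c + u * dir) := by
    rw [dir_eq_neg_conj_rot, map_add, map_mul, conj_ofReal, conj_ofReal]
    push_cast; ring
  rw [ofReal_add_mul_rot, map_mul, ← neg_mul, ← dir_eq_neg_conj_rot] at hneg
  rw [← neg_eq_iff_eq_neg] at hneg
  rw [← hneg, map_add, map_mul, conj_ofReal, conj_ofReal, conj_I]
  push_cast; ring

theorem sin_mul_dir_eq (p : ℂ) : sin (π * (dir * p)) = conj (sin (π * (rot * -conj p))) := by
  rw [dir_eq_neg_conj_rot, ← sin_conj, map_mul, map_mul, map_neg, conj_conj, conj_ofReal]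
  ring_nf

theorem sin_mul_dir_ne_zero {p : ℂ} (hp : |p.im| < 1 / 2) (hp0 : p ≠ 0) :
    sin (π * (dir * p)) ≠ 0 := by
  rw [sin_mul_dir_eq, (map_ne_zero conj)]
  exact sin_mul_rot_ne_zero (by rwa [neg_im, conj_im, neg_neg])
    (neg_ne_zero.2 ((map_ne_zero _).2 hp0))

theorem half_le_norm_sin_mul_dir {p : ℂ} (hp : 1 / 2 ≤ |p.im + p.re|) :
    1 / 2 ≤ ‖sin (π * (dir * p))‖ := by
  rw [sin_mul_dir_eq, norm_conj]
  exact half_le_norm_sin_mul_rot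
    (by rwa [neg_im, conj_im, neg_neg, neg_re, conj_re, sub_neg_eq_add])

theorem dir_mul_re_nonneg_or_im_ne_zero {p : ℂ} (hp : 0 ≤ p.im) :
    0 ≤ (dir * p).re ∨ (dir * p).im ≠ 0 := by
  rw [dir_mul_re, dir_mul_im, neg_ne_zero, or_iff_not_imp_right, not_not]
  intro h
  have hsum : p.re + p.im = 0 := (mul_eq_zero.1 h).resolve_left (by positivity)
  exact mul_nonneg (by positivity) (by linarith)

theorem dir_mul_mem_slitPlane {p : ℂ} (hp : 0 < p.im) : dir * p ∈ slitPlane := by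
  rw [mem_slitPlane_iff, dir_mul_re, dir_mul_im, neg_ne_zero, or_iff_not_imp_right, not_not]
  intro h
  have hsum : p.re + p.im = 0 := (mul_eq_zero.1 h).resolve_left (by positivity)
  exact mul_pos (by positivity) (by linarith)

theorem kernel_eq (s x : ℂ) :
    kernel s x = x ^ (-s) * exp (π * I * x ^ 2) / (2 * I * sin (π * x)) := by
  rw [kernel, exp_sub_exp_neg]

theorem hasDerivAt_two_I_mul_sin_pi_mul_zero :
    HasDerivAt (fun x : ℂ => 2 * I * sin (π * x)) (2 * I * π) 0 := by
  simpa only [mul_zero, Complex.cos_zero, one_mul, mul_one, id_eq]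
    using (((hasDerivAt_id (0 : ℂ)).const_mul (π : ℂ)).csin.const_mul (2 * I))

theorem dslope_two_I_mul_sin_pi_mul {x : ℂ} (hx : x ≠ 0) :
    dslope (fun x : ℂ => 2 * I * sin (π * x)) 0 x = 2 * I * sin (π * x) / x := by
  rw [dslope_of_ne _ hx, slope_def_field, mul_zero, Complex.sin_zero, mul_zero, sub_zero, sub_zero]

theorem kernel_eq_cpow_mul_div_dslope {s : ℂ} (hs : s.re < -1) (x : ℂ) :
    kernel s x = x ^ (-s - 1) * exp (π * I * x ^ 2) /
      dslope (fun x : ℂ => 2 * I * sin (π * x)) 0 x := by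
  rw [kernel_eq]
  rcases eq_or_ne x 0 with rfl | hx
  · have hne : -s ≠ 0 := fun h => by
      have := congrArg re h
      rw [neg_re, zero_re] at this
      linarith
    have hne' : -s - 1 ≠ 0 := fun h => by
      have := congrArg re h
      rw [sub_re, neg_re, one_re, zero_re] at this
      linarith
    rw [zero_cpow hne, zero_cpow hne', zero_mul, zero_div, zero_div]
  · rw [dslope_two_I_mul_sin_pi_mul hx, cpow_sub _ _ hx, cpow_one]
    field_simp

/- As `Re s < -1`, the zero of `x^(-s)` at the origin absorbs the pole of `1 / sin πx`. -/
theorem continuousOn_kernel_dir {s : ℂ} (hs : s.re < -1) :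
    ContinuousOn (fun p => kernel s (dir * p)) {p | p.im ∈ Ico 0 (1 / 2)} := by
  have hdslope : Differentiable ℂ (dslope (fun x : ℂ => 2 * I * sin (π * x)) 0) := by
    rw [← differentiableOn_univ, differentiableOn_dslope univ_mem, differentiableOn_univ]
    fun_prop
  simp only [kernel_eq_cpow_mul_div_dslope hs]
  refine fun p hp => ContinuousAt.continuousWithinAt (ContinuousAt.div
    (ContinuousAt.mul ?_ (by fun_prop)) ?_ ?_)
  · refine ContinuousAt.comp (f := fun p => dir * p) (g := fun x : ℂ => x ^ (-s - 1))
      (continuousAt_cpow_const_of_re_pos (dir_mul_re_nonneg_or_im_ne_zero hp.1) ?_) (by fun_prop)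
    rw [sub_re, neg_re, one_re]; linarith
  · exact hdslope.continuous.continuousAt.comp (by fun_prop)
  · rcases eq_or_ne p 0 with rfl | hp0
    · rw [mul_zero, dslope_same, hasDerivAt_two_I_mul_sin_pi_mul_zero.deriv]
      exact mul_ne_zero (mul_ne_zero two_ne_zero I_ne_zero) (ofReal_ne_zero.2 Real.pi_ne_zero)
    · rw [dslope_two_I_mul_sin_pi_mul (mul_ne_zero dir_ne_zero hp0)]
      exact div_ne_zero (mul_ne_zero (mul_ne_zero two_ne_zero I_ne_zero)
        (sin_mul_dir_ne_zero (by rw [abs_of_nonneg hp.1]; exact hp.2) hp0))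
        (mul_ne_zero dir_ne_zero hp0)

theorem differentiableOn_kernel_dir (s : ℂ) :
    DifferentiableOn ℂ (fun p => kernel s (dir * p)) {p | p.im ∈ Ioo 0 (1 / 2)} := by
  simp only [kernel_eq]
  intro p hp
  have hp0 : p ≠ 0 := fun h => by simpa [h] using hp.1
  refine (DifferentiableAt.div (DifferentiableAt.mul ?_ (by fun_prop)) (by fun_prop) ?_
    ).differentiableWithinAt
  · exact DifferentiableAt.cpow_const (by fun_prop) (dir_mul_mem_slitPlane hp.1)
  · exact mul_ne_zero (mul_ne_zero two_ne_zero I_ne_zero)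
      (sin_mul_dir_ne_zero (by rw [abs_of_pos hp.1]; exact hp.2) hp0)

theorem pow_le_factorial_mul_exp (k : ℕ) {x : ℝ} (hx : 0 ≤ x) :
    x ^ k ≤ k.factorial * Real.exp x := by
  have h := Real.pow_div_factorial_le_exp x hx k
  rwa [div_le_iff₀' (by positivity)] at h

theorem norm_cpow_neg_le {x s : ℂ} {k : ℕ} (hx : 1 ≤ ‖x‖) (hk : -s.re ≤ k) :
    ‖x ^ (-s)‖ ≤ ‖x‖ ^ k * Real.exp (π * |s.im|) := by
  rw [norm_cpow_of_ne_zero (norm_pos_iff.1 (by linarith)), div_eq_mul_inv, ← Real.exp_neg,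
    ← Real.rpow_natCast]
  gcongr
  · rwa [neg_re]
  · refine (le_abs_self _).trans ?_
    rw [abs_neg, abs_mul, neg_im, abs_neg]
    gcongr
    exact abs_arg_le_pi _

theorem norm_exp_pi_I_mul_dir_sq (p : ℂ) :
    ‖exp (π * I * (dir * p) ^ 2)‖ = Real.exp (-π * (p.re ^ 2 - p.im ^ 2)) := by
  rw [norm_exp, mul_pow, dir_sq, show π * I * (I * p ^ 2) = ((-π : ℝ) : ℂ) * p ^ 2 by
    push_cast; linear_combination (π * p ^ 2) * I_sq, re_ofReal_mul, sq p, mul_re, sq, sq]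

theorem one_le_norm_two_I_mul_sin_mul_dir {u τ : ℝ} (hu : 1 ≤ |u|) (hτ : |τ| ≤ 1 / 2) :
    1 ≤ ‖2 * I * sin (π * (dir * (u + τ * I)))‖ := by
  have h := half_le_norm_sin_mul_dir (p := u + τ * I) (by
    simp only [add_im, ofReal_im, im_ofReal_mul, I_im, mul_one, zero_add, add_re, ofReal_re,
      re_ofReal_mul, I_re, mul_zero, add_zero]
    have := abs_sub_abs_le_abs_sub u (-τ)
    rw [abs_neg, sub_neg_eq_add, add_comm] at this
    linarith)
  rw [norm_mul, norm_mul, norm_I, Complex.norm_ofNat, mul_one]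
  linarith

theorem exists_norm_kernel_dir_le (s : ℂ) :
    ∃ C : ℝ, ∀ u τ : ℝ, 1 ≤ |u| → |τ| ≤ 1 / 2 →
      ‖kernel s (dir * (u + τ * I))‖ ≤ C * Real.exp (-u ^ 2) := by
  obtain ⟨k, hk⟩ := exists_nat_ge (-s.re)
  refine ⟨k.factorial * Real.exp 1 * Real.exp (π * |s.im|) * Real.exp π, fun u τ hu hτ => ?_⟩
  have hre : ((u : ℂ) + τ * I).re = u := by simp
  have him : ((u : ℂ) + τ * I).im = τ := by simp
  have one_le_norm : 1 ≤ ‖dir * (u + τ * I)‖ := by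
    have := abs_re_le_norm ((u : ℂ) + τ * I)
    rw [hre] at this
    rw [norm_mul, norm_dir, one_mul]
    linarith
  have norm_le : ‖dir * (u + τ * I)‖ ≤ 2 * |u| := by
    have := norm_le_abs_re_add_abs_im ((u : ℂ) + τ * I)
    rw [hre, him] at this
    rw [norm_mul, norm_dir, one_mul]
    linarith
  have hgauss : ‖exp (π * I * (dir * (u + τ * I)) ^ 2)‖ ≤ Real.exp (π + -2 * u ^ 2) := by
    rw [norm_exp_pi_I_mul_dir_sq, hre, him, Real.exp_le_exp]
    have hτ1 : τ ^ 2 ≤ 1 := by rw [← sq_abs]; nlinarith [abs_nonneg τ]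
    nlinarith [Real.pi_gt_three, sq_nonneg u]
  have hpow : (2 * |u|) ^ k ≤ k.factorial * Real.exp (1 + u ^ 2) := by
    refine (pow_le_factorial_mul_exp k (by positivity)).trans ?_
    gcongr
    rw [← sq_abs]; nlinarith [sq_nonneg (|u| - 1)]
  rw [kernel_eq, norm_div, norm_mul]
  calc _ ≤ ‖(dir * (u + τ * I)) ^ (-s)‖ * ‖exp (π * I * (dir * (u + τ * I)) ^ 2)‖ :=
        div_le_self (by positivity) (one_le_norm_two_I_mul_sin_mul_dir hu hτ)
    _ ≤ (2 * |u|) ^ k * Real.exp (π * |s.im|) * Real.exp (π + -2 * u ^ 2) := by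
        gcongr
        exact (norm_cpow_neg_le one_le_norm hk).trans (by gcongr)
    _ ≤ k.factorial * Real.exp (1 + u ^ 2) * Real.exp (π * |s.im|) *
        Real.exp (π + -2 * u ^ 2) := by gcongr
    _ = k.factorial * Real.exp 1 * Real.exp (π * |s.im|) * Real.exp π *
        (Real.exp (u ^ 2) * Real.exp (-2 * u ^ 2)) := by rw [Real.exp_add, Real.exp_add]; ring
    _ = _ := by rw [← Real.exp_add]; ring_nf

theorem integrable_of_le_exp_neg_sq {f : ℝ → ℂ} (hf : Continuous f) {C : ℝ}
    (h : ∀ u, 1 ≤ |u| → ‖f u‖ ≤ C * Real.exp (-u ^ 2)) : Integrable f := by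
  refine hf.locallyIntegrable.integrable_of_isBigO_atBot_atTop
    (g := fun u => Real.exp (-u ^ 2)) (g' := fun u => Real.exp (-u ^ 2)) ?_
    (integrable_exp_neg_sq.integrableAtFilter _) ?_ (integrable_exp_neg_sq.integrableAtFilter _)
  · refine Asymptotics.IsBigO.of_bound C ?_
    filter_upwards [eventually_le_atBot (-1)] with u hu
    rw [Real.norm_of_nonneg (Real.exp_pos _).le]
    exact h u (le_abs.2 (Or.inr (by linarith)))
  · refine Asymptotics.IsBigO.of_bound C ?_
    filter_upwards [eventually_ge_atTop 1] with u hu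
    rw [Real.norm_of_nonneg (Real.exp_pos _).le]
    exact h u (le_abs.2 (Or.inl hu))

theorem integrable_kernel_dir_line {s : ℂ} (hs : s.re < -1) {τ : ℝ} (hτ : τ ∈ Ico 0 (1 / 2)) :
    Integrable fun u : ℝ => kernel s (dir * (u + τ * I)) := by
  obtain ⟨C, hC⟩ := exists_norm_kernel_dir_le s
  exact integrable_of_le_exp_neg_sq
    ((continuousOn_kernel_dir hs).comp_continuous (f := fun u : ℝ => (u : ℂ) + τ * I)
      (by fun_prop) fun u => by simpa using hτ)
    fun u hu => hC u τ hu (by rw [abs_of_nonneg hτ.1]; exact hτ.2.le)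

theorem vanishesAtStripEnds_kernel_dir (s : ℂ) {ε : ℝ} (hε : ε ≤ 1 / 2) :
    VanishesAtStripEnds (fun p => kernel s (dir * p)) 0 ε := by
  obtain ⟨C, hC⟩ := exists_norm_kernel_dir_le s
  refine ⟨fun x => C * Real.exp (-x ^ 2), ?_, fun u τ hu hτ => ?_⟩
  · simpa only [mul_zero, Function.comp_def] using (Real.tendsto_exp_neg_atTop_nhds_zero.comp
      (tendsto_pow_atTop (α := ℝ) two_ne_zero)).const_mul C
  · simpa only [sq_abs] using hC u τ hu (by rw [abs_of_nonneg hτ.1]; exact hτ.2.trans hε)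

theorem auxR_eq_integral_through_zero {s : ℂ} (hs : s.re < -1) :
    auxR s = (∫ u : ℝ, kernel s (dir * u)) * dir := by
  have hε : √2 / 2 * (1 / 2) < 1 / 2 := by linarith [Real.sqrt_two_lt_three_halves]
  have hε0 : 0 ≤ √2 / 2 * (1 / 2) := by positivity
  have hshift := integral_eq_of_strip hε0
    ((continuousOn_kernel_dir hs).mono fun p hp => ⟨hp.1, hp.2.trans_lt hε⟩)
    ((differentiableOn_kernel_dir s).mono fun p hp => ⟨hp.1, hp.2.trans hε⟩)
    (vanishesAtStripEnds_kernel_dir s hε.le)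
    (integrable_kernel_dir_line hs ⟨le_rfl, one_half_pos⟩)
    (integrable_kernel_dir_line hs ⟨hε0, hε⟩)
  simp only [ofReal_zero, zero_mul, add_zero] at hshift
  rw [hshift, ← integral_sub_right_eq_self _ (√2 / 2 * (1 / 2)), ← integral_mul_const, auxR, ← dir]
  refine integral_congr_ae (Eventually.of_forall fun u => ?_)
  have hline := ofReal_add_mul_dir (1 / 2) u
  rw [ofReal_div, ofReal_one, ofReal_ofNat] at hline
  simp only [hline]

/-! ### Fubini and the integral of `Gamma` -/

/-- The unit vector `e^{πi/4}`, opposite to `dir`: rotating both halves of the path of `auxR` onto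
it brings out the two exponentials that make up `χ`. -/
noncomputable def ray : ℂ := exp (π * I / 4)

theorem ray_eq_conj_rot : ray = conj rot := by
  rw [ray, rot, ← exp_conj]
  simp only [map_neg, map_div₀, map_mul, conj_ofReal, conj_I, map_ofNat, mul_neg, neg_div, neg_neg]

theorem dir_eq_neg_ray : dir = -ray := by rw [dir_eq_neg_conj_rot, ray_eq_conj_rot]

theorem ray_mul_rot : ray * rot = 1 := by
  rw [ray, rot, ← Complex.exp_add, add_neg_cancel, Complex.exp_zero]

theorem neg_I_mul_ray : -I * ray = rot := by
  rw [← rot_sq, sq, mul_assoc, mul_comm rot ray, ray_mul_rot, mul_one]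

theorem ray_im : ray.im = √2 / 2 := by
  rw [ray_eq_conj_rot, conj_im, rot_im, neg_neg]

theorem ofReal_mul_exp_mul_I_cpow {u θ : ℝ} (hu : 0 < u) (hθ : θ ∈ Ioc (-π) π) (s : ℂ) :
    (u * exp (θ * I)) ^ s = (u : ℂ) ^ s * exp (θ * I * s) := by
  have hu0 : (u : ℂ) ≠ 0 := ofReal_ne_zero.2 hu.ne'
  have him : ((θ : ℂ) * I).im = θ := by simp
  rw [cpow_def_of_ne_zero (mul_ne_zero hu0 (exp_ne_zero _)), log_ofReal_mul hu (exp_ne_zero _),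
    log_exp (by rw [him]; exact hθ.1) (by rw [him]; exact hθ.2), cpow_def_of_ne_zero hu0,
    ← Complex.exp_add, ofReal_log hu.le]
  ring_nf

theorem ofReal_mul_ray_cpow {u : ℝ} (hu : 0 < u) (s : ℂ) :
    (u * ray : ℂ) ^ (-s) = (u : ℂ) ^ (-s) * exp (-(π * I * s / 4)) := by
  have hθ : π / 4 ∈ Ioc (-π) π := ⟨by linarith [Real.pi_pos], by linarith [Real.pi_pos]⟩
  have h := ofReal_mul_exp_mul_I_cpow hu hθ (-s)
  rw [show ((π / 4 : ℝ) : ℂ) * I = π * I / 4 by push_cast; ring, ← ray] at h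
  rw [h]
  ring_nf

theorem ofReal_mul_dir_cpow {u : ℝ} (hu : 0 < u) (s : ℂ) :
    (u * dir : ℂ) ^ (-s) = (u : ℂ) ^ (-s) * exp (3 * π * I * s / 4) := by
  have hθ : -(3 * π / 4) ∈ Ioc (-π) π := ⟨by linarith [Real.pi_pos], by linarith [Real.pi_pos]⟩
  have h := ofReal_mul_exp_mul_I_cpow hu hθ (-s)
  rw [show ((-(3 * π / 4) : ℝ) : ℂ) * I = -(3 * π * I / 4) by push_cast; ring, ← dir] at h
  rw [h]
  ring_nf

/-- The integrand of `auxR` at `u e^{πi/4}`, up to the power `(e^{πi/4})^{-s}` of the direction. -/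
noncomputable def rayIntegrand (s : ℂ) (u : ℝ) : ℂ :=
  (u : ℂ) ^ (-s) * (exp (π * I * (u * ray) ^ 2) / (2 * I * sin (π * (u * ray))))

theorem kernel_dir_neg {u : ℝ} (hu : 0 < u) (s : ℂ) :
    kernel s (dir * ((-u : ℝ) : ℂ)) = exp (-(π * I * s / 4)) * rayIntegrand s u := by
  rw [show dir * ((-u : ℝ) : ℂ) = u * ray by rw [dir_eq_neg_ray]; push_cast; ring, kernel_eq,
    ofReal_mul_ray_cpow hu, rayIntegrand]
  ring

theorem kernel_dir_pos {u : ℝ} (hu : 0 < u) (s : ℂ) :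
    kernel s (dir * u) = -exp (3 * π * I * s / 4) * rayIntegrand s u := by
  rw [mul_comm dir, kernel_eq, ofReal_mul_dir_cpow hu, rayIntegrand,
    show u * dir = -(u * ray) by rw [dir_eq_neg_ray]; ring, neg_sq, mul_neg, Complex.sin_neg,
    mul_neg, div_neg]
  ring

theorem integrable_kernel_dir {s : ℂ} (hs : s.re < -1) :
    Integrable fun u : ℝ => kernel s (dir * u) := by
  simpa only [ofReal_zero, zero_mul, add_zero]
    using integrable_kernel_dir_line hs (τ := 0) ⟨le_rfl, one_half_pos⟩

theorem integrableOn_rayIntegrand {s : ℂ} (hs : s.re < -1) :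
    IntegrableOn (rayIntegrand s) (Ioi 0) := by
  have h : IntegrableOn (fun u : ℝ => -exp (-(3 * π * I * s / 4)) * kernel s (dir * u)) (Ioi 0) :=
    ((integrable_kernel_dir hs).integrableOn (s := Ioi 0)).const_mul _
  refine h.congr_fun (fun u hu => ?_) measurableSet_Ioi
  simp only [kernel_dir_pos hu]
  rw [← mul_assoc, neg_mul_neg, ← Complex.exp_add, neg_add_cancel, Complex.exp_zero, one_mul]

theorem auxR_eq_ray {s : ℂ} (hs : s.re < -1) :
    auxR s = (exp (3 * π * I * s / 4) - exp (-(π * I * s / 4))) * ray *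
      ∫ u in Ioi (0 : ℝ), rayIntegrand s u := by
  have hline := integrable_kernel_dir hs
  have hneg : ∫ u in Iic (0 : ℝ), kernel s (dir * u) =
      exp (-(π * I * s / 4)) * ∫ u in Ioi (0 : ℝ), rayIntegrand s u := by
    have hflip := integral_comp_neg_Ioi (0 : ℝ) (fun u : ℝ => kernel s (dir * u))
    rw [neg_zero] at hflip
    rw [← hflip, ← integral_const_mul]
    exact setIntegral_congr_fun measurableSet_Ioi fun u hu => kernel_dir_neg hu s
  have hpos : ∫ u in Ioi (0 : ℝ), kernel s (dir * u) =
      -exp (3 * π * I * s / 4) * ∫ u in Ioi (0 : ℝ), rayIntegrand s u := by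
    rw [← integral_const_mul]
    exact setIntegral_congr_fun measurableSet_Ioi fun u hu => kernel_dir_pos hu s
  rw [auxR_eq_integral_through_zero hs,
    ← intervalIntegral.integral_Iic_add_Ioi (b := 0) hline.integrableOn hline.integrableOn,
    hneg, hpos, dir_eq_neg_ray]
  ring

theorem re_pos_ne_zero {z : ℂ} (hz : 0 < z.re) : z ≠ 0 := fun h => by simp [h] at hz

theorem log_rot_mul {x : ℂ} (hx : 0 < (rot * x).re) : log (rot * x) = log x - π * I / 4 := by
  have hexp : x = exp (log (rot * x) + π * I / 4) := by
    rw [Complex.exp_add, exp_log (re_pos_ne_zero hx), ← ray, mul_comm, ← mul_assoc, ray_mul_rot,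
      one_mul]
  have him : (log (rot * x) + π * I / 4).im = (rot * x).arg + π / 4 := by
    simp [log_im]
  have harg := abs_lt.1 (abs_arg_lt_pi_div_two_iff.2 (Or.inl hx))
  have hlog : log x = log (rot * x) + π * I / 4 := by
    conv_lhs => rw [hexp]
    rw [log_exp] <;> rw [him] <;> linarith [Real.pi_pos, harg.1, harg.2]
  rw [hlog, add_sub_cancel_right]

theorem two_pi_mul_rot_mul_re (x : ℂ) : (2 * π * (rot * x)).re = 2 * π * (rot * x).re := by
  rw [← re_ofReal_mul]; push_cast; rfl

theorem one_div_two_pi_mul_rot_mul_cpow {x : ℂ} (hx : 0 < (rot * x).re) (s : ℂ) :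
    (1 / (2 * π * (rot * x))) ^ (1 - s) =
      (2 * π : ℂ) ^ (s - 1) * exp (-(π * I * (s - 1) / 4)) * x ^ (s - 1) := by
  have hre : 0 < (2 * π * (rot * x)).re := by
    rw [two_pi_mul_rot_mul_re]; exact mul_pos Real.two_pi_pos hx
  have harg : (2 * π * (rot * x)).arg ≠ π := fun h => by
    have := abs_lt.1 (abs_arg_lt_pi_div_two_iff.2 (Or.inl hre))
    linarith [Real.pi_pos]
  have hlog : log (2 * π * (rot * x)) = (Real.log (2 * π) : ℂ) + log (rot * x) := by
    rw [← log_ofReal_mul Real.two_pi_pos (re_pos_ne_zero hx)]; push_cast; rfl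
  have h2π : (2 * π : ℂ) ≠ 0 := by exact_mod_cast Real.two_pi_pos.ne'
  rw [one_div, inv_cpow _ _ harg, ← cpow_neg, cpow_def_of_ne_zero (re_pos_ne_zero hre), hlog,
    log_rot_mul hx, cpow_def_of_ne_zero h2π,
    cpow_def_of_ne_zero (right_ne_zero_of_mul (re_pos_ne_zero hx)), ← Complex.exp_add,
    ← Complex.exp_add, ofReal_log Real.two_pi_pos.le]
  push_cast
  ring_nf

theorem exp_mul_ray (x u : ℂ) :
    exp (2 * π * I * x * (u * ray)) = exp (-(2 * π * (rot * x) * u)) := by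
  rw [← neg_I_mul_ray]; ring_nf

/-- The factor by which `x^{s-1}` is multiplied in the transform `integral_cpow_mul_exp_ray`. -/
noncomputable def rayConst (s : ℂ) : ℂ :=
  Gamma (1 - s) * ((2 * π : ℂ) ^ (s - 1) * exp (-(π * I * (s - 1) / 4)))

theorem integral_cpow_mul_exp_ray {s x : ℂ} (hs : s.re < 1) (hx : 0 < (rot * x).re) :
    ∫ u in Ioi (0 : ℝ), (u : ℂ) ^ (-s) * exp (2 * π * I * x * (u * ray)) =
      rayConst s * x ^ (s - 1) := by
  have h := integral_cpow_mul_exp_neg_mul_Ioi_of_re_pos (a := 1 - s) (r := 2 * π * (rot * x))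
    (by rw [sub_re, one_re]; linarith)
    (by rw [two_pi_mul_rot_mul_re]; exact mul_pos Real.two_pi_pos hx)
  rw [show (1 : ℂ) - s - 1 = -s by ring, one_div_two_pi_mul_rot_mul_cpow hx] at h
  simp only [exp_mul_ray]
  rw [h, rayConst]
  ring

theorem integrableOn_cpow_mul_exp_ray {s x : ℂ} (hs : s.re < 1) (hx : 0 < (rot * x).re) :
    IntegrableOn (fun u : ℝ => (u : ℂ) ^ (-s) * exp (2 * π * I * x * (u * ray))) (Ioi 0) := by
  simp only [exp_mul_ray]
  exact integrableOn_cpow_mul_exp_neg (by rw [neg_re]; linarith)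
    (by rw [two_pi_mul_rot_mul_re]; exact mul_pos Real.two_pi_pos hx)

theorem integral_norm_cpow_mul_exp_ray {s x : ℂ} (hs : s.re < 1) (hx : 0 < (rot * x).re) :
    ∫ u in Ioi (0 : ℝ), ‖(u : ℂ) ^ (-s) * exp (2 * π * I * x * (u * ray))‖ =
      (1 / (2 * π * (rot * x).re)) ^ (1 - s.re) * Real.Gamma (1 - s.re) := by
  rw [← Real.integral_rpow_mul_exp_neg_mul_Ioi (by linarith) (mul_pos Real.two_pi_pos hx)]
  refine setIntegral_congr_fun measurableSet_Ioi fun u hu => ?_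
  simp only [exp_mul_ray]
  rw [norm_cpow_mul_exp_neg _ _ hu, two_pi_mul_rot_mul_re, neg_re, sub_sub_cancel_left]

theorem rot_mul_natCast_re (n : ℕ) : (rot * n).re = √2 / 2 * n := by
  rw [mul_re, natCast_re, natCast_im, rot_re, mul_zero, sub_zero]

theorem summable_integral_norm_cpow_mul_exp_ray {s : ℂ} (hs : s.re < 0) :
    Summable fun n : ℕ =>
      ∫ u in Ioi (0 : ℝ), ‖(u : ℂ) ^ (-s) * exp (2 * π * I * (n + 1 : ℕ) * (u * ray))‖ := by
  have hsum : Summable fun n : ℕ => ((n + 1 : ℕ) : ℝ) ^ (s.re - 1) :=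
    (summable_nat_add_iff 1).2 (Real.summable_nat_rpow.2 (by linarith))
  refine ((hsum.mul_left ((2 * π * (√2 / 2))⁻¹ ^ (1 - s.re))).mul_right
    (Real.Gamma (1 - s.re))).congr fun n => ?_
  rw [integral_norm_cpow_mul_exp_ray (by linarith) (by rw [rot_mul_natCast_re]; positivity),
    rot_mul_natCast_re, one_div, ← mul_assoc, mul_inv (2 * π * (√2 / 2)),
    Real.mul_rpow (by positivity) (by positivity), Real.inv_rpow (Nat.cast_nonneg (n + 1)),
    ← Real.rpow_neg (Nat.cast_nonneg (n + 1)), neg_sub]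

theorem hasSum_rayConst_mul_cpow {s : ℂ} (hs : s.re < 0) (N : ℕ) :
    HasSum (fun k : ℕ => rayConst s * ((N + 1 + k : ℕ) : ℂ) ^ (s - 1))
      (∫ u in Ioi (0 : ℝ), (u : ℂ) ^ (-s) *
        ∑' k : ℕ, exp (2 * π * I * ((N + 1 + k : ℕ) : ℂ) * (u * ray))) := by
  have hre : ∀ k : ℕ, 0 < (rot * (N + 1 + k : ℕ)).re := fun k => by
    rw [rot_mul_natCast_re]; positivity
  have hsummable := (summable_nat_add_iff N).2 (summable_integral_norm_cpow_mul_exp_ray hs)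
  simp only [show ∀ k, k + N + 1 = N + 1 + k from fun k => by ring] at hsummable
  have h := hasSum_integral_of_summable_integral_norm
    (fun k => integrableOn_cpow_mul_exp_ray (by linarith) (hre k)) hsummable
  simp only [tsum_mul_left] at h
  exact h.congr_fun fun k => (integral_cpow_mul_exp_ray (by linarith) (hre k)).symm

/-- The numerator `x^{s-1} e^{-πi x²}` of the integrand into which the integral over `u` turns the
Mordell integral at `y = u e^{πi/4}`. -/
noncomputable def powGauss (s x : ℂ) : ℂ := x ^ (s - 1) * exp (-(π * I * x ^ 2))

/-- The integrand of the double integral whose two orders of integration relate `auxR` to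
`lineInt (powGauss s)`. -/
noncomputable def doubleKernel (s : ℂ) (N : ℕ) (u v : ℝ) : ℂ :=
  (u : ℂ) ^ (-s) * (quad 1 (u * ray) (N + 1 / 2 + v * rot) /
    (2 * I * sin (π * (N + 1 / 2 + v * rot))) * rot)

theorem quad_one_eq (y x : ℂ) : quad 1 y x = exp (-(π * I * x ^ 2)) * exp (2 * π * I * x * y) := by
  rw [quad, ← Complex.exp_add, ofReal_one]; ring_nf

theorem rot_mul_line_re (N : ℕ) (v : ℝ) :
    (rot * (N + 1 / 2 + v * rot)).re = √2 / 2 * (N + 1 / 2) := by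
  rw [show rot * (N + 1 / 2 + v * rot) = rot * (N + 1 / 2) + v * rot ^ 2 by ring, rot_sq]
  simp

/- The only factor that couples `u` and `v` is unimodular, because `e^{πi/4} e^{-πi/4} = 1`. -/
theorem doubleKernel_eq (s : ℂ) (N : ℕ) (u v : ℝ) :
    doubleKernel s N u v = exp (((2 * π * (u * v) : ℝ) : ℂ) * I) *
      (((u : ℂ) ^ (-s) * exp (2 * π * I * (N + 1 / 2) * (u * ray))) *
        (quad 1 0 (N + 1 / 2 + v * rot) / (2 * I * sin (π * (N + 1 / 2 + v * rot))) * rot)) := by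
  have hexp : exp (2 * π * I * (N + 1 / 2 + v * rot) * (u * ray)) =
      exp (((2 * π * (u * v) : ℝ) : ℂ) * I) * exp (2 * π * I * (N + 1 / 2) * (u * ray)) := by
    rw [← Complex.exp_add]
    congr 1; push_cast
    linear_combination (2 * π * I * v * u) * ray_mul_rot
  rw [doubleKernel, quad_one_eq, quad_one_eq, mul_zero, Complex.exp_zero, mul_one, hexp]
  ring

theorem integrable_doubleKernel {s : ℂ} (hs : s.re < 1) (N : ℕ) :
    Integrable (Function.uncurry (doubleKernel s N)) ((volume.restrict (Ioi 0)).prod volume) := by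
  have hu : IntegrableOn (fun u : ℝ => (u : ℂ) ^ (-s) *
      exp (2 * π * I * (N + 1 / 2) * (u * ray))) (Ioi 0) := by
    refine integrableOn_cpow_mul_exp_ray hs ?_
    have h := rot_mul_line_re N 0
    rw [ofReal_zero, zero_mul, add_zero] at h
    rw [h]
    positivity
  have hv := integrable_quad_div_sin_line le_rfl 0 N
  simp only [Int.cast_natCast] at hv
  refine ((hu.mul_prod hv).bdd_mul (c := 1)
    (f := fun z : ℝ × ℝ => exp (((2 * π * (z.1 * z.2) : ℝ) : ℂ) * I))
    (Continuous.aestronglyMeasurable (by fun_prop))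
    (Eventually.of_forall fun z => (norm_exp_ofReal_mul_I _).le)).congr
    (Eventually.of_forall fun z => ?_)
  rw [Function.uncurry, doubleKernel_eq]

theorem integral_doubleKernel_right (s : ℂ) (N : ℕ) (u : ℝ) :
    ∫ v, doubleKernel s N u v = (u : ℂ) ^ (-s) * lineInt (quad 1 (u * ray)) (N + 1 / 2) := by
  simp only [doubleKernel, lineInt, integral_const_mul]

theorem integral_doubleKernel_left {s : ℂ} (hs : s.re < 1) (N : ℕ) (v : ℝ) :
    ∫ u in Ioi (0 : ℝ), doubleKernel s N u v =
      rayConst s * (powGauss s (N + 1 / 2 + v * rot) /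
        (2 * I * sin (π * (N + 1 / 2 + v * rot))) * rot) := by
  have h := integral_cpow_mul_exp_ray (x := N + 1 / 2 + v * rot) hs
    (by rw [rot_mul_line_re]; positivity)
  have hfactor : ∀ u : ℝ, doubleKernel s N u v =
      ((u : ℂ) ^ (-s) * exp (2 * π * I * (N + 1 / 2 + v * rot) * (u * ray))) *
      (exp (-(π * I * (N + 1 / 2 + v * rot) ^ 2)) /
        (2 * I * sin (π * (N + 1 / 2 + v * rot))) * rot) := fun u => by
    rw [doubleKernel, quad_one_eq]; ring
  simp only [hfactor]
  rw [integral_mul_const, h, powGauss]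
  ring

theorem integral_cpow_mul_lineInt_quad {s : ℂ} (hs : s.re < 1) (N : ℕ) :
    ∫ u in Ioi (0 : ℝ), (u : ℂ) ^ (-s) * lineInt (quad 1 (u * ray)) (N + 1 / 2) =
      rayConst s * lineInt (powGauss s) (N + 1 / 2) := by
  simp only [← integral_doubleKernel_right]
  rw [integral_integral_swap (integrable_doubleKernel hs N)]
  simp only [integral_doubleKernel_left hs]
  rw [integral_const_mul, lineInt]

theorem integrableOn_cpow_mul_lineInt_quad {s : ℂ} (hs : s.re < 1) (N : ℕ) :
    IntegrableOn (fun u : ℝ => (u : ℂ) ^ (-s) * lineInt (quad 1 (u * ray)) (N + 1 / 2))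
      (Ioi 0) :=
  (integrable_doubleKernel hs N).integral_prod_left.congr
    (Eventually.of_forall fun u => integral_doubleKernel_right s N u)

theorem exp_sub_exp_mul_ray_eq_sin (s : ℂ) :
    (exp (3 * π * I * s / 4) - exp (-(π * I * s / 4))) * ray * exp (-(π * I * (s - 1) / 4)) =
      -(2 * sin (π * s / 2)) := by
  have hsin : 2 * sin (π * s / 2) = exp (-(π * s / 2 * I) + π / 2 * I) -
      exp (π * s / 2 * I + π / 2 * I) := by
    rw [Complex.exp_add, Complex.exp_add, exp_pi_div_two_mul_I, Complex.sin, neg_mul]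
    ring
  rw [hsin, ray, sub_mul, sub_mul, neg_sub]
  simp only [← Complex.exp_add]
  ring_nf

theorem exp_sub_exp_mul_ray_mul_rayConst (s : ℂ) :
    (exp (3 * π * I * s / 4) - exp (-(π * I * s / 4))) * ray * rayConst s = -chi s := by
  have h2π : (2 * π : ℂ) ^ (s - 1) = 2 ^ (s - 1) * (π : ℂ) ^ (s - 1) := by
    simpa only [ofReal_ofNat] using mul_cpow_ofReal_nonneg zero_le_two Real.pi_pos.le (s - 1)
  have h2 : (2 : ℂ) ^ s = 2 * 2 ^ (s - 1) := by
    rw [cpow_sub _ _ two_ne_zero, cpow_one]; field_simp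
  rw [rayConst, chi, h2π, h2]
  linear_combination (Gamma (1 - s) * 2 ^ (s - 1) * (π : ℂ) ^ (s - 1)) *
    exp_sub_exp_mul_ray_eq_sin s

theorem auxR_eq_chi_mul_tsum_sub_lineInt {s : ℂ} (hs : s.re < -1) (N : ℕ) :
    auxR s = chi s * ((∑' k : ℕ, ((N + 1 + k : ℕ) : ℂ) ^ (s - 1)) -
      lineInt (powGauss s) (N + 1 / 2)) := by
  have hmordell : ∀ u ∈ Ioi (0 : ℝ), rayIntegrand s u =
      (u : ℂ) ^ (-s) * lineInt (quad 1 (u * ray)) (N + 1 / 2) -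
        (u : ℂ) ^ (-s) * ∑' k : ℕ, exp (2 * π * I * ((N + 1 + k : ℕ) : ℂ) * (u * ray)) :=
    fun u hu => by
      have him : 0 < ((u : ℂ) * ray).im := by
        rw [im_ofReal_mul, ray_im]
        exact mul_pos hu (by positivity)
      rw [rayIntegrand, exp_div_sin_eq_lineInt_sub_tsum him N, mul_sub]
  have hlineInt := integrableOn_cpow_mul_lineInt_quad (show s.re < 1 by linarith) N
  have htsum : IntegrableOn (fun u : ℝ => (u : ℂ) ^ (-s) *
      ∑' k : ℕ, exp (2 * π * I * ((N + 1 + k : ℕ) : ℂ) * (u * ray))) (Ioi 0) := by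
    refine (hlineInt.sub (integrableOn_rayIntegrand hs)).congr_fun (fun u hu => ?_)
      measurableSet_Ioi
    rw [Pi.sub_apply, hmordell u hu, sub_sub_cancel]
  rw [auxR_eq_ray hs, setIntegral_congr_fun measurableSet_Ioi hmordell,
    integral_sub hlineInt htsum, integral_cpow_mul_lineInt_quad (by linarith),
    ← (hasSum_rayConst_mul_cpow (by linarith) N).tsum_eq, tsum_mul_left]
  linear_combination (lineInt (powGauss s) (N + 1 / 2) -
    ∑' k : ℕ, ((N + 1 + k : ℕ) : ℂ) ^ (s - 1)) * exp_sub_exp_mul_ray_mul_rayConst s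

/-! ### The integrand near the saddle point -/

theorem norm_exp_sub_one_le (z : ℂ) : ‖exp z - 1‖ ≤ ‖z‖ * (1 + ‖exp z‖) := by
  have hderiv : ∀ t ∈ Icc (0 : ℝ) 1,
      HasDerivWithinAt (fun t : ℝ => exp (t * z)) (exp (t * z) * z) (Icc 0 1) t := fun t _ => by
    simpa only [id, one_mul, ofReal_one] using
      ((hasDerivAt_id t).ofReal_comp.mul_const z).cexp.hasDerivWithinAt
  have hbound : ∀ t ∈ Ico (0 : ℝ) 1, ‖exp (t * z) * z‖ ≤ ‖z‖ * (1 + ‖exp z‖) := fun t ht => by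
    rw [norm_mul, mul_comm, norm_exp, norm_exp, re_ofReal_mul]
    gcongr
    rcases le_total z.re 0 with hz | hz
    · have : Real.exp (t * z.re) ≤ 1 :=
        Real.exp_le_one_iff.2 (mul_nonpos_of_nonneg_of_nonpos ht.1 hz)
      linarith [Real.exp_pos z.re]
    · have : Real.exp (t * z.re) ≤ Real.exp z.re :=
        Real.exp_le_exp.2 (mul_le_of_le_one_left hz ht.2.le)
      linarith
  simpa only [ofReal_one, one_mul, ofReal_zero, zero_mul, exp_zero] using
    norm_image_sub_le_of_norm_deriv_le_segment_01' hderiv hbound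

theorem mem_slitPlane_of_re_add_im_pos {z : ℂ} (h : 0 < z.re + z.im) : z ∈ slitPlane := by
  rw [mem_slitPlane_iff]
  by_cases hi : z.im = 0
  · left; linarith
  · exact Or.inr hi

theorem sq_re_add_im_le (z : ℂ) : (z.re + z.im) ^ 2 ≤ 2 * ‖z‖ ^ 2 := by
  rw [← normSq_eq_norm_sq, normSq_apply]; nlinarith [sq_nonneg (z.re - z.im)]

theorem half_re_add_im_le_norm (z : ℂ) : (z.re + z.im) / 2 ≤ ‖z‖ := by
  linarith [re_le_norm z, im_le_norm z]

theorem norm_le_re_add_im {z : ℂ} (hre : 0 ≤ z.re) (him : 0 ≤ z.im) : ‖z‖ ≤ z.re + z.im := by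
  simpa only [abs_of_nonneg hre, abs_of_nonneg him] using norm_le_abs_re_add_abs_im z

theorem re_add_im_offset (η : ℂ) (δ v : ℝ) :
    (η + (δ + v * rot)).re + (η + (δ + v * rot)).im = η.re + η.im + δ := by
  simp only [add_re, add_im, ofReal_re, ofReal_im, re_ofReal_mul, im_ofReal_mul, rot_re, rot_im]
  ring

theorem le_re_add_im_segment {η d : ℂ} {τ a : ℝ} (h0 : 0 ≤ τ) (h1 : τ ≤ 1)
    (hη : a ≤ η.re + η.im) (hx : a ≤ (η + d).re + (η + d).im) :
    a ≤ (η + τ * d).re + (η + τ * d).im := by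
  simp only [add_re, add_im, re_ofReal_mul, im_ofReal_mul] at hx ⊢
  nlinarith

theorem I_mul_sq_offset (δ v : ℝ) :
    I * (δ + v * rot) ^ 2 = ((v ^ 2 : ℝ) : ℂ) + (I * δ ^ 2 + 2 * I * δ * v * rot) := by
  push_cast
  linear_combination (I * (v : ℂ) ^ 2) * rot_sq - (v : ℂ) ^ 2 * I_sq

theorem norm_offset_cross_le (δ v : ℝ) :
    ‖I * δ ^ 2 + 2 * I * δ * v * rot‖ ≤ δ ^ 2 + 2 * |δ| * |v| := by
  refine (norm_add_le _ _).trans (le_of_eq ?_)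
  simp only [norm_mul, norm_pow, norm_I, norm_real, Real.norm_eq_abs, sq_abs, Complex.norm_ofNat,
    norm_rot, one_mul, mul_one]

/-- The logarithm of `x^{s-1} e^{-πi x²}`, relative to its value at the saddle point `η`, where
`s - 1 = 2πi η²`. -/
noncomputable def logRatio (η x : ℂ) : ℂ :=
  2 * π * I * η ^ 2 * (log x - log η) - π * I * (x ^ 2 - η ^ 2)

theorem logRatio_self (η : ℂ) : logRatio η η = 0 := by simp [logRatio]

theorem hasDerivAt_logRatio_segment (η d : ℂ) (τ : ℝ) (h : η + τ * d ∈ slitPlane) :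
    HasDerivAt (fun τ : ℝ => logRatio η (η + τ * d))
      (-(2 * π * I * d ^ 2 * τ * (1 + η / (η + τ * d)))) τ := by
  have hne : η + τ * d ≠ 0 := slitPlane_ne_zero h
  have hseg : HasDerivAt (fun τ : ℝ => η + (τ : ℂ) * d) (1 * d) τ :=
    ((hasDerivAt_id τ).ofReal_comp.mul_const d).const_add η
  have hlog := (((hseg.clog_real h).sub_const (log η)).const_mul (2 * π * I * η ^ 2)).sub
    (((hseg.pow 2).sub_const (η ^ 2)).const_mul (π * I))
  refine hlog.congr_deriv ?_
  obtain ⟨γ, hγ⟩ : ∃ γ, γ = η + τ * d := ⟨_, rfl⟩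
  rw [← hγ] at hne ⊢
  rw [eq_sub_of_add_eq hγ.symm]
  field_simp
  push_cast
  ring

/- Cauchy's mean value theorem against `τ ^ 2`: the derivative along the segment has a factor `τ`,
so the increment is quadratic in `d`. -/
theorem exists_re_logRatio_eq {η d : ℂ} (hη : 0 < η.re + η.im)
    (hx : 0 < (η + d).re + (η + d).im) :
    ∃ τ ∈ Ioo (0 : ℝ) 1,
      (logRatio η (η + d)).re = -π * (I * d ^ 2 * (1 + η / (η + τ * d))).re := by
  have hslit : ∀ τ ∈ Icc (0 : ℝ) 1, η + τ * d ∈ slitPlane := fun τ hτ =>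
    mem_slitPlane_of_re_add_im_pos ((lt_min hη hx).trans_le
      (le_re_add_im_segment hτ.1 hτ.2 (min_le_left _ _) (min_le_right _ _)))
  have hderiv : ∀ τ ∈ Icc (0 : ℝ) 1, HasDerivAt (fun τ : ℝ => (logRatio η (η + τ * d)).re)
      (-(2 * π * I * d ^ 2 * τ * (1 + η / (η + τ * d)))).re τ := fun τ hτ =>
    reCLM.hasFDerivAt.comp_hasDerivAt τ (hasDerivAt_logRatio_segment η d τ (hslit τ hτ))
  obtain ⟨τ, hτ, hmean⟩ := exists_ratio_hasDerivAt_eq_ratio_slope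
    (fun τ : ℝ => (logRatio η (η + τ * d)).re)
    (fun τ : ℝ => (-(2 * π * I * d ^ 2 * τ * (1 + η / (η + τ * d)))).re) one_pos
    (fun τ hτ => (hderiv τ hτ).continuousAt.continuousWithinAt)
    (fun τ hτ => hderiv τ (Ioo_subset_Icc_self hτ))
    (fun τ : ℝ => τ ^ 2) (fun τ => 2 * τ) (by fun_prop)
    (fun τ _ => by simpa using hasDerivAt_pow 2 τ)
  refine ⟨τ, hτ, ?_⟩
  simp only [ofReal_one, one_mul, ofReal_zero, zero_mul, add_zero, logRatio_self, zero_re, sub_zero,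
    one_pow, ne_eq, OfNat.ofNat_ne_zero, not_false_eq_true, zero_pow] at hmean
  have hfactor : -(2 * π * I * d ^ 2 * τ * (1 + η / (η + τ * d))) =
      ((-(2 * π * τ) : ℝ) : ℂ) * (I * d ^ 2 * (1 + η / (η + τ * d))) := by push_cast; ring
  rw [hfactor, re_ofReal_mul] at hmean
  have hτ0 : 2 * τ ≠ 0 := mul_ne_zero two_ne_zero hτ.1.ne'
  apply mul_right_cancel₀ hτ0
  rw [← hmean]; ring

theorem neg_half_le_re_div {η γ : ℂ} (hγ : γ ≠ 0) (h : ‖η‖ ≤ ‖γ + η‖) : -(1 / 2) ≤ (η / γ).re := by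
  have hpos : 0 < normSq γ := normSq_pos.2 hγ
  have hnormSq : normSq η ≤ normSq (γ + η) := by
    rw [normSq_eq_norm_sq, normSq_eq_norm_sq]; gcongr
  rw [div_re, ← add_div, le_div_iff₀ hpos]
  simp only [normSq_apply, add_re, add_im] at hpos hnormSq ⊢
  nlinarith

theorem neg_half_le_re_div_of_near {η γ : ℂ} (hX : 0 ≤ η.re) (hy : 0 ≤ η.im)
    (h1 : 1 ≤ η.re + η.im) (hγ : η.re + η.im - 1 / 2 ≤ γ.re + γ.im) :
    -(1 / 2) ≤ (η / γ).re := by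
  have hγ0 : γ ≠ 0 := slitPlane_ne_zero (mem_slitPlane_of_re_add_im_pos (by linarith))
  refine neg_half_le_re_div hγ0 (le_of_sq_le_sq ?_ (norm_nonneg _))
  have hsum : 2 * (η.re + η.im) - 1 / 2 ≤ (γ + η).re + (γ + η).im := by
    rw [add_re, add_im]; linarith
  have hsq : (2 * (η.re + η.im) - 1 / 2) ^ 2 ≤ ((γ + η).re + (γ + η).im) ^ 2 :=
    pow_le_pow_left₀ (by linarith) hsum 2
  have hnorm : ‖η‖ ^ 2 ≤ (η.re + η.im) ^ 2 :=
    pow_le_pow_left₀ (norm_nonneg η) (norm_le_re_add_im hX hy) 2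
  nlinarith [sq_re_add_im_le (γ + η)]

theorem norm_one_add_div_le {η γ : ℂ} (hX : 0 ≤ η.re) (hy : 0 ≤ η.im) (h1 : 1 ≤ η.re + η.im)
    (hγ : η.re + η.im - 1 / 2 ≤ γ.re + γ.im) : ‖1 + η / γ‖ ≤ 5 := by
  have hγn : (η.re + η.im) / 4 ≤ ‖γ‖ := by linarith [half_re_add_im_le_norm γ]
  have hdiv : ‖η‖ / ‖γ‖ ≤ 4 := by
    rw [div_le_iff₀ (by linarith)]; linarith [norm_le_re_add_im hX hy]
  refine (norm_add_le _ _).trans ?_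
  rw [norm_one, norm_div]
  linarith

theorem re_logRatio_le {η : ℂ} (hX : 0 ≤ η.re) (hy : 0 ≤ η.im) (h1 : 1 ≤ η.re + η.im) {δ v : ℝ}
    (hδ : |δ| ≤ 1 / 2) :
    (logRatio η (η + (δ + v * rot))).re ≤ -(π * v ^ 2 / 2) + 5 * π * (δ ^ 2 + 2 * |δ| * |v|) := by
  have hsum := re_add_im_offset η δ v
  have hδ' := neg_le_of_abs_le hδ
  obtain ⟨τ, hτ, hmean⟩ := exists_re_logRatio_eq (η := η) (d := δ + v * rot) (by linarith)
    (by linarith)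
  set γ : ℂ := η + τ * (δ + v * rot)
  have hγ : η.re + η.im - 1 / 2 ≤ γ.re + γ.im :=
    le_re_add_im_segment hτ.1.le hτ.2.le (by linarith) (by linarith)
  have hre := neg_half_le_re_div_of_near hX hy h1 hγ
  have hcross : ‖(I * δ ^ 2 + 2 * I * δ * v * rot) * (1 + η / γ)‖ ≤
      (δ ^ 2 + 2 * |δ| * |v|) * 5 := by
    rw [norm_mul]
    gcongr
    · exact norm_offset_cross_le δ v
    · exact norm_one_add_div_le hX hy h1 hγ
  have hcross_re := neg_le_of_abs_le ((abs_re_le_norm _).trans hcross)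
  rw [hmean, I_mul_sq_offset, add_mul, add_re, re_ofReal_mul, add_re, one_re]
  have hmain : v ^ 2 / 2 ≤ v ^ 2 * (1 + (η / γ).re) := by nlinarith [sq_nonneg v]
  nlinarith [Real.pi_pos]

theorem norm_logRatio_add_le {η d : ℂ} (hη : 0 < η.re + η.im)
    (hx : (η.re + η.im) / 2 ≤ (η + d).re + (η + d).im) :
    ‖logRatio η (η + d) + 2 * π * I * d ^ 2‖ ≤ 8 * π * ‖d‖ ^ 3 / (η.re + η.im) := by
  set a := η.re + η.im
  have hseg : ∀ τ ∈ Icc (0 : ℝ) 1, a / 2 ≤ (η + τ * d).re + (η + τ * d).im := fun τ hτ =>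
    le_re_add_im_segment hτ.1 hτ.2 (by linarith) hx
  have hderiv : ∀ τ ∈ Icc (0 : ℝ) 1, HasDerivWithinAt
      (fun τ : ℝ => logRatio η (η + τ * d) + 2 * π * I * d ^ 2 * (τ : ℂ) ^ 2)
      (2 * π * I * d ^ 3 * (τ : ℂ) ^ 2 / (η + τ * d)) (Icc 0 1) τ := fun τ hτ => by
    have hslit := mem_slitPlane_of_re_add_im_pos ((half_pos hη).trans_le (hseg τ hτ))
    have hsq := ((hasDerivAt_id τ).ofReal_comp.pow 2).const_mul (2 * π * I * d ^ 2)
    refine (((hasDerivAt_logRatio_segment η d τ hslit).add hsq).congr_deriv ?_).hasDerivWithinAt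
    have hdiv : η / (η + τ * d) = 1 - τ * d / (η + τ * d) := by
      rw [one_sub_div (slitPlane_ne_zero hslit), add_sub_cancel_right]
    rw [hdiv]
    simp only [id, ofReal_one, mul_one, Nat.cast_ofNat, Nat.add_one_sub_one, pow_one]
    ring
  have hbound : ∀ τ ∈ Ico (0 : ℝ) 1,
      ‖2 * π * I * d ^ 3 * (τ : ℂ) ^ 2 / (η + τ * d)‖ ≤ 8 * π * ‖d‖ ^ 3 / a := fun τ hτ => by
    have hγ : a / 4 ≤ ‖η + τ * d‖ := by
      linarith [half_re_add_im_le_norm (η + τ * d), hseg τ (Ico_subset_Icc_self hτ)]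
    rw [norm_div, div_le_div_iff₀ (by linarith) hη]
    simp only [norm_mul, norm_pow, norm_I, Complex.norm_ofNat, norm_real, Real.norm_eq_abs,
      abs_of_pos Real.pi_pos, sq_abs, mul_one]
    have hτ2 : τ ^ 2 ≤ 1 := pow_le_one₀ hτ.1 hτ.2.le
    calc 2 * π * ‖d‖ ^ 3 * τ ^ 2 * a ≤ 2 * π * ‖d‖ ^ 3 * 1 * a := by gcongr
      _ = 8 * π * ‖d‖ ^ 3 * (a / 4) := by ring
      _ ≤ 8 * π * ‖d‖ ^ 3 * ‖η + τ * d‖ := by gcongr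
  simpa [logRatio_self] using norm_image_sub_le_of_norm_deriv_le_segment_01' hderiv hbound

theorem norm_exp_logRatio_sub_le {η d : ℂ} (hη : 0 < η.re + η.im)
    (hx : (η.re + η.im) / 2 ≤ (η + d).re + (η + d).im) :
    ‖exp (logRatio η (η + d)) - saddleGauss η (η + d)‖ ≤
      8 * π * ‖d‖ ^ 3 / (η.re + η.im) *
        (‖exp (logRatio η (η + d))‖ + ‖saddleGauss η (η + d)‖) := by
  have hlog := norm_logRatio_add_le hη hx
  set L := logRatio η (η + d)
  set E := L + 2 * π * I * d ^ 2
  have hexp : exp L = saddleGauss η (η + d) * exp E := by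
    rw [saddleGauss, add_sub_cancel_left, ← Complex.exp_add]; congr 1; ring
  rw [hexp, ← mul_sub_one, norm_mul, norm_mul]
  calc ‖saddleGauss η (η + d)‖ * ‖exp E - 1‖
      ≤ ‖saddleGauss η (η + d)‖ * (‖E‖ * (1 + ‖exp E‖)) := by gcongr; exact norm_exp_sub_one_le E
    _ = ‖E‖ * (‖saddleGauss η (η + d)‖ * ‖exp E‖ + ‖saddleGauss η (η + d)‖) := by ring
    _ ≤ _ := by gcongr

theorem norm_saddleGauss_le (η : ℂ) (δ v : ℝ) :
    ‖saddleGauss η (η + (δ + v * rot))‖ ≤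
      Real.exp (-(2 * π * v ^ 2) + 2 * π * (δ ^ 2 + 2 * |δ| * |v|)) := by
  rw [saddleGauss, add_sub_cancel_left, norm_exp, Real.exp_le_exp]
  have hsplit : -(2 * π * I * (δ + v * rot) ^ 2) = ((-(2 * π) : ℝ) : ℂ) *
      (((v ^ 2 : ℝ) : ℂ) + (I * δ ^ 2 + 2 * I * δ * v * rot)) := by
    rw [← I_mul_sq_offset]; push_cast; ring
  rw [hsplit, re_ofReal_mul, add_re, ofReal_re]
  have hcross := neg_le_of_abs_le ((abs_re_le_norm _).trans (norm_offset_cross_le δ v))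
  nlinarith [Real.pi_pos]

/-! ### The line integral -/

theorem line_eq_saddle_add (η : ℂ) (N : ℕ) (v : ℝ) :
    (N : ℂ) + 1 / 2 + v * rot =
      η + (((N + 1 / 2 - (η.re + η.im) : ℝ) : ℂ) + ((v + √2 * η.im : ℝ) : ℂ) * rot) := by
  have hsqrt : √2 * √2 = 2 := Real.mul_self_sqrt zero_le_two
  apply Complex.ext
  · simp only [add_re, natCast_re, re_ofReal_mul, ofReal_re, rot_re, div_ofNat_re, one_re]
    linear_combination (-η.im / 2) * hsqrt
  · simp only [add_im, natCast_im, im_ofReal_mul, ofReal_im, rot_im, div_ofNat_im, one_im]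
    linear_combination (η.im / 2) * hsqrt

theorem exp_le_four_mul_norm_sin_line (N : ℕ) (v y : ℝ) :
    Real.exp (π * y - π * |v + √2 * y|) ≤ 4 * ‖sin (π * ((N : ℂ) + 1 / 2 + v * rot))‖ := by
  have hsin := half_cosh_le_norm_sin_line N v
  rw [Int.cast_natCast] at hsin
  have hsqrt : √2 * √2 = 2 := Real.mul_self_sqrt zero_le_two
  have habs : √2 * y - |v + √2 * y| ≤ |v| := by
    linarith [le_abs_self (v + √2 * y), neg_abs_le v]
  have hscaled : y - |v + √2 * y| ≤ √2 / 2 * |v| := by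
    have hsqrt_le : √2 ≤ 2 := Real.sqrt_le_iff.2 ⟨zero_le_two, by norm_num⟩
    have hexpand : √2 / 2 * (√2 * y - |v + √2 * y|) = y - √2 / 2 * |v + √2 * y| := by
      linear_combination (y / 2) * hsqrt
    have hshrink : √2 / 2 * |v + √2 * y| ≤ |v + √2 * y| :=
      mul_le_of_le_one_left (abs_nonneg _) (by linarith)
    linarith [mul_le_mul_of_nonneg_left habs (by positivity : 0 ≤ √2 / 2)]
  have hexp : Real.exp (π * y - π * |v + √2 * y|) ≤ Real.exp |π * (√2 / 2) * v| := by
    rw [Real.exp_le_exp, abs_mul, abs_of_pos (by positivity : 0 < π * (√2 / 2))]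
    linarith [mul_le_mul_of_nonneg_left hscaled Real.pi_pos.le]
  rw [← Real.cosh_abs, Real.cosh_eq] at hsin
  linarith [Real.exp_pos (-|π * (√2 / 2) * v|)]

theorem norm_exp_logRatio_offset_sub_le {η : ℂ} (hy : 0 ≤ η.im) (hX : 1 ≤ η.re) {δ : ℝ}
    (hδ : |δ| ≤ 1 / 2) (w : ℝ) :
    ‖exp (logRatio η (η + (δ + w * rot))) - saddleGauss η (η + (δ + w * rot))‖ ≤
      16 * π / η.re * Real.exp (-(π * w ^ 2 / 2) + 5 * π * (1 / 4 + |w|) + 3 * |w|) := by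
  have hsum := re_add_im_offset η δ w
  have hδ2 : δ ^ 2 ≤ 1 / 4 := by rw [← sq_abs]; nlinarith [abs_nonneg δ]
  have hcross : δ ^ 2 + 2 * |δ| * |w| ≤ 1 / 4 + |w| := by nlinarith [abs_nonneg w]
  have hcross_nonneg : 0 ≤ δ ^ 2 + 2 * |δ| * |w| := by positivity
  set B : ℝ := Real.exp (-(π * w ^ 2 / 2) + 5 * π * (1 / 4 + |w|)) with hB
  have hratio : ‖exp (logRatio η (η + (δ + w * rot)))‖ ≤ B := by
    rw [norm_exp, hB, Real.exp_le_exp]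
    refine (re_logRatio_le (by linarith) hy (by linarith) hδ).trans ?_
    gcongr
  have hgauss : ‖saddleGauss η (η + (δ + w * rot))‖ ≤ B := by
    refine (norm_saddleGauss_le η δ w).trans ?_
    rw [hB, Real.exp_le_exp]
    nlinarith [sq_nonneg w, Real.pi_pos]
  have hcube : ‖(δ : ℂ) + w * rot‖ ^ 3 ≤ Real.exp (3 * |w|) := by
    have hnorm : ‖(δ : ℂ) + w * rot‖ ≤ Real.exp |w| := by
      refine (norm_add_le _ _).trans ?_
      rw [norm_mul, norm_rot, mul_one, norm_real, norm_real, Real.norm_eq_abs, Real.norm_eq_abs]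
      linarith [Real.add_one_le_exp |w|]
    calc ‖(δ : ℂ) + w * rot‖ ^ 3 ≤ Real.exp |w| ^ 3 := by gcongr
      _ = Real.exp (3 * |w|) := by rw [← Real.exp_nat_mul, Nat.cast_ofNat]
  calc _ ≤ _ := norm_exp_logRatio_sub_le (by linarith)
        (by rw [hsum]; linarith [neg_le_of_abs_le hδ])
    _ ≤ 8 * π * Real.exp (3 * |w|) / η.re * (B + B) := by
        gcongr
        linarith
    _ = _ := by rw [Real.exp_add _ (3 * |w|)]; ring

/- At signed distance `w` from the point of the line nearest to the saddle, `1 / sin` is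
`O(e^{π|w| - π Im η})`, and the Gaussian decay absorbs `e^{π|w|}`. -/
theorem norm_line_diff_le {η : ℂ} (hy : 0 ≤ η.im) (hX : 1 ≤ η.re) {N : ℕ}
    (hN1 : (N : ℝ) ≤ η.re + η.im) (hN2 : η.re + η.im ≤ N + 1) (v : ℝ) :
    ‖(exp (logRatio η (N + 1 / 2 + v * rot)) - saddleGauss η (N + 1 / 2 + v * rot)) /
      (2 * I * sin (π * (N + 1 / 2 + v * rot))) * rot‖ ≤
      32 * π * Real.exp 246 / η.re * Real.exp (-(π * η.im)) *
        Real.exp (-(v + √2 * η.im) ^ 2) := by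
  have hsin := exp_le_four_mul_norm_sin_line N v η.im
  have hnum := norm_exp_logRatio_offset_sub_le (δ := N + 1 / 2 - (η.re + η.im)) hy hX
    (abs_le.2 ⟨by linarith, by linarith⟩) (v + √2 * η.im)
  rw [← line_eq_saddle_add] at hnum
  set w : ℝ := v + √2 * η.im
  rw [norm_mul, norm_rot, mul_one, norm_div, norm_mul, norm_mul, norm_I, Complex.norm_ofNat,
    mul_one]
  have hexponent : -(π * w ^ 2 / 2) + 5 * π * (1 / 4 + |w|) + 3 * |w| - (π * η.im - π * |w|) ≤
      246 - π * η.im - w ^ 2 := by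
    rw [← sq_abs w]
    nlinarith [sq_nonneg (|w| - 22), abs_nonneg w, Real.pi_gt_three, Real.pi_lt_d2]
  calc _ ≤ 16 * π / η.re * Real.exp (-(π * w ^ 2 / 2) + 5 * π * (1 / 4 + |w|) + 3 * |w|) /
          (Real.exp (π * η.im - π * |w|) / 2) :=
        div_le_div₀ (by positivity) hnum (by positivity) (by linarith)
    _ = 32 * π / η.re * Real.exp (-(π * w ^ 2 / 2) + 5 * π * (1 / 4 + |w|) + 3 * |w| -
          (π * η.im - π * |w|)) := by rw [Real.exp_sub (_ + 3 * |w|)]; ring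
    _ ≤ 32 * π / η.re * Real.exp (246 - π * η.im - w ^ 2) := by gcongr
    _ = _ := by rw [sub_eq_add_neg, sub_eq_add_neg, Real.exp_add, Real.exp_add]; ring

theorem integral_exp_neg_add_sq (b : ℝ) : ∫ v : ℝ, Real.exp (-(v + b) ^ 2) = √π := by
  rw [integral_add_right_eq_self (fun v : ℝ => Real.exp (-v ^ 2)) b]
  simpa using integral_gaussian 1

theorem integrable_saddleGauss_line (η : ℂ) (N : ℕ) :
    Integrable fun v : ℝ => saddleGauss η (N + 1 / 2 + v * rot) /
      (2 * I * sin (π * (N + 1 / 2 + v * rot))) * rot := by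
  have hquad := (integrable_quad_div_sin_line one_le_two (2 * η) N).const_mul
    (exp (-(2 * π * I * η ^ 2)))
  refine hquad.congr (Eventually.of_forall fun v => ?_)
  simp only [Int.cast_natCast]
  rw [saddleGauss_eq_mul_quad]
  ring

theorem continuous_line_diff (η : ℂ) (N : ℕ) :
    Continuous fun v : ℝ =>
      (exp (logRatio η (N + 1 / 2 + v * rot)) - saddleGauss η (N + 1 / 2 + v * rot)) /
      (2 * I * sin (π * (N + 1 / 2 + v * rot))) * rot := by
  have hlog : Continuous fun v : ℝ => log ((N : ℂ) + 1 / 2 + v * rot) :=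
    Continuous.clog (by fun_prop) fun v => by
      have hsum := re_add_im_offset 0 (N + 1 / 2) v
      push_cast at hsum
      rw [zero_add] at hsum
      apply mem_slitPlane_of_re_add_im_pos
      rw [hsum, zero_re, zero_im]
      positivity
  have hsin : ∀ v : ℝ, 2 * I * sin (π * ((N : ℂ) + 1 / 2 + v * rot)) ≠ 0 := fun v =>
    mul_ne_zero (mul_ne_zero two_ne_zero I_ne_zero) (by simpa using sin_line_ne_zero N v)
  unfold logRatio saddleGauss
  exact (Continuous.div (by fun_prop) (by fun_prop) hsin).mul continuous_const

theorem norm_lineInt_sub_le {η : ℂ} (hy : 0 ≤ η.im) (hX : 1 ≤ η.re) {N : ℕ}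
    (hN1 : (N : ℝ) ≤ η.re + η.im) (hN2 : η.re + η.im ≤ N + 1) :
    ‖lineInt (fun x => exp (logRatio η x)) (N + 1 / 2) - lineInt (saddleGauss η) (N + 1 / 2)‖ ≤
      32 * π * Real.exp 246 / η.re * Real.exp (-(π * η.im)) * √π := by
  have hbound := norm_line_diff_le hy hX hN1 hN2
  have hmajorant := (integrable_exp_neg_sq.comp_add_right (√2 * η.im)).const_mul
    (32 * π * Real.exp 246 / η.re * Real.exp (-(π * η.im)))
  have hgauss := integrable_saddleGauss_line η N
  have hratio : Integrable fun v : ℝ => exp (logRatio η (N + 1 / 2 + v * rot)) /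
      (2 * I * sin (π * (N + 1 / 2 + v * rot))) * rot := by
    have hdiff := Integrable.mono' hmajorant (continuous_line_diff η N).aestronglyMeasurable
      (Eventually.of_forall hbound)
    refine (hdiff.add hgauss).congr (Eventually.of_forall fun v => ?_)
    simp only [Pi.add_apply]
    ring
  rw [lineInt, lineInt, ← integral_sub hratio hgauss]
  have hint := norm_integral_le_of_norm_le hmajorant (Eventually.of_forall hbound)
  rw [integral_const_mul, integral_exp_neg_add_sq] at hint
  refine le_of_eq_of_le ?_ hint
  congr 2; ext v; ring

/-! ### The tail of the sum -/

theorem re_logRatio_ofReal (η : ℂ) {x₁ x₂ : ℝ} (h1 : 0 < x₁) (h2 : 0 < x₂) :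
    (logRatio η x₂).re = (logRatio η x₁).re - 4 * π * η.re * η.im * Real.log (x₂ / x₁) := by
  have hdiff : logRatio η x₂ = logRatio η x₁ +
      ((2 * π * Real.log (x₂ / x₁) : ℝ) : ℂ) * (I * η ^ 2) -
        ((π * (x₂ ^ 2 - x₁ ^ 2) : ℝ) : ℂ) * I := by
    rw [logRatio, logRatio, ← ofReal_log h1.le, ← ofReal_log h2.le, Real.log_div h2.ne' h1.ne']
    push_cast; ring
  have hre : (I * η ^ 2).re = -(2 * η.re * η.im) := by
    rw [I_mul_re, sq, mul_im]; ring
  rw [hdiff, sub_re, add_re, re_ofReal_mul, re_ofReal_mul, hre, I_re]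
  ring

theorem add_mul_rot_eq_re_add_im (η : ℂ) :
    η + ((0 : ℝ) + (√2 * η.im : ℝ) * rot) = ((η.re + η.im : ℝ) : ℂ) := by
  have hsqrt : √2 * √2 = 2 := Real.mul_self_sqrt zero_le_two
  apply Complex.ext
  · simp only [add_re, ofReal_re, re_ofReal_mul, rot_re]
    linear_combination (η.im / 2) * hsqrt
  · simp only [add_im, ofReal_im, im_ofReal_mul, rot_im]
    linear_combination (-η.im / 2) * hsqrt

theorem re_logRatio_re_add_im_le {η : ℂ} (hX : 0 ≤ η.re) (hy : 0 ≤ η.im)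
    (h1 : 1 ≤ η.re + η.im) : (logRatio η ((η.re + η.im : ℝ) : ℂ)).re ≤ -(π * η.im ^ 2) := by
  have hle := re_logRatio_le (δ := 0) (v := √2 * η.im) hX hy h1 (by norm_num)
  rw [add_mul_rot_eq_re_add_im, mul_pow, Real.sq_sqrt zero_le_two, abs_zero] at hle
  linarith

theorem re_logRatio_ofReal_le_of_le {η : ℂ} (hy : 0 ≤ η.im) (hX : 1 ≤ η.re) {n : ℝ}
    (hn : η.re + η.im ≤ n) (hn4 : n ≤ 4 * η.re) :
    (logRatio η n).re ≤ -(π * η.im * (n - η.re)) := by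
  have hbase := re_logRatio_re_add_im_le (by linarith : 0 ≤ η.re) hy (by linarith)
  have hx0 : 0 < η.re + η.im := by linarith
  have hn0 : 0 < n := hx0.trans_le hn
  rw [re_logRatio_ofReal η hx0 hn0]
  have hlog : (n - η.re - η.im) / (4 * η.re) ≤ Real.log (n / (η.re + η.im)) :=
    calc (n - η.re - η.im) / (4 * η.re) ≤ (n - η.re - η.im) / n :=
          div_le_div_of_nonneg_left (by linarith) hn0 hn4
      _ = 1 - (n / (η.re + η.im))⁻¹ := by rw [inv_div]; field_simp; ring
      _ ≤ _ := Real.one_sub_inv_le_log_of_pos (by positivity)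
  rw [div_le_iff₀ (by linarith)] at hlog
  have hslope := mul_le_mul_of_nonneg_left hlog (by positivity : 0 ≤ π * η.im)
  linarith

theorem re_logRatio_ofReal_le_of_ge {η : ℂ} (hy : 0 ≤ η.im) (hyX : η.im ≤ η.re) (hX : 1 ≤ η.re)
    (hm : 5 ≤ 4 * π * η.re * η.im) {n : ℝ} (hn4 : 4 * η.re ≤ n) :
    (logRatio η n).re ≤ 3 - 2 * π * η.re * η.im - 5 * Real.log (n / (2 * η.re)) := by
  have hbase := re_logRatio_re_add_im_le (by linarith : 0 ≤ η.re) hy (by linarith)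
  have hx0 : 0 < η.re + η.im := by linarith
  have hn0 : 0 < n := by linarith
  rw [re_logRatio_ofReal η hx0 hn0]
  have hhalf : 1 / 2 ≤ Real.log (n / (η.re + η.im)) := by
    have hlog := Real.log_le_log zero_lt_two
      ((le_div_iff₀ hx0).2 (by linarith) : 2 ≤ n / (η.re + η.im))
    linarith [Real.log_two_gt_d9]
  have hmono : Real.log (n / (2 * η.re)) ≤ Real.log (n / (η.re + η.im)) :=
    Real.log_le_log (by positivity) (div_le_div_of_nonneg_left hn0.le hx0 (by linarith))
  nlinarith [sq_nonneg η.im, Real.pi_pos]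

theorem norm_exp_logRatio_ofReal_le {η : ℂ} (hy : 0 ≤ η.im) (hyX : η.im ≤ η.re) (hX : 1 ≤ η.re)
    (hm : 5 ≤ 4 * π * η.re * η.im) {n : ℝ} (hn : η.re + η.im ≤ n) :
    ‖exp (logRatio η n)‖ ≤ Real.exp (-(π * η.im * (n - η.re))) +
      32 * Real.exp 3 * Real.exp (-(2 * π * η.re * η.im)) * (η.re / n) ^ 5 := by
  have hn0 : 0 < n := by linarith
  rw [norm_exp]
  rcases le_total n (4 * η.re) with hn4 | hn4
  · exact (Real.exp_le_exp.2 (re_logRatio_ofReal_le_of_le hy hX hn hn4)).trans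
      (le_add_of_nonneg_right (by positivity))
  · refine (Real.exp_le_exp.2 (re_logRatio_ofReal_le_of_ge hy hyX hX hm hn4)).trans
      (le_add_of_nonneg_of_le (Real.exp_pos _).le (le_of_eq ?_))
    have hpow : Real.exp (-(5 * Real.log (n / (2 * η.re)))) = 32 * (η.re / n) ^ 5 := by
      rw [← mul_neg, ← Real.log_inv, inv_div, mul_comm, ← Real.rpow_def_of_pos (by positivity),
        Real.rpow_ofNat]
      ring
    rw [sub_eq_add_neg, sub_eq_add_neg, Real.exp_add, Real.exp_add, hpow]
    ring

theorem two_thirds_mul_le_one_sub_exp {a : ℝ} (h0 : 0 ≤ a) (h1 : a ≤ 1) :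
    2 / 3 * a ≤ 1 - Real.exp (-(2 * a)) := by
  have hexp : Real.exp (-(2 * a)) ≤ 1 / (1 + 2 * a) := by
    rw [Real.exp_neg, one_div]
    apply inv_anti₀ (by linarith)
    linarith [Real.add_one_le_exp (2 * a)]
  have hdiv : 1 / (1 + 2 * a) ≤ 1 - 2 / 3 * a := by
    rw [div_le_iff₀ (by linarith)]; nlinarith
  linarith

theorem cube_mul_exp_le {y D : ℝ} {k : ℕ} (hy : 0 < y) (hD : y + k ≤ D) :
    D ^ 3 * Real.exp (-(π * y * D)) ≤
      6 * Real.exp π * Real.exp (-(π * y)) / (min y 1) ^ 3 * Real.exp (-(2 * min y 1)) ^ k := by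
  have hD0 : 0 < D := by linarith
  set a := min y 1 with ha
  have ha0 : 0 < a := lt_min hy one_pos
  have hlinear : a * D + y ≤ y * D + 1 := by
    rcases le_total y 1 with h | h
    · rw [ha, min_eq_left h]; linarith
    · rw [ha, min_eq_right h]; nlinarith
  have hcube : a ^ 3 * D ^ 3 ≤ 6 * Real.exp (a * D) := by
    rw [← mul_pow]
    simpa [Nat.factorial] using pow_le_factorial_mul_exp 3 (by positivity : 0 ≤ a * D)
  have hexp : Real.exp (a * D) * Real.exp (-(π * y * D)) ≤
      Real.exp π * Real.exp (-(π * y)) * Real.exp (-(2 * a)) ^ k := by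
    rw [← Real.exp_nat_mul, ← Real.exp_add, ← Real.exp_add, ← Real.exp_add, Real.exp_le_exp]
    nlinarith [mul_pos ha0 hD0, Real.pi_gt_three]
  rw [div_mul_eq_mul_div, le_div_iff₀ (by positivity)]
  calc D ^ 3 * Real.exp (-(π * y * D)) * a ^ 3 = a ^ 3 * D ^ 3 * Real.exp (-(π * y * D)) := by ring
    _ ≤ 6 * Real.exp (a * D) * Real.exp (-(π * y * D)) := by gcongr
    _ = 6 * (Real.exp (a * D) * Real.exp (-(π * y * D))) := by ring
    _ ≤ 6 * (Real.exp π * Real.exp (-(π * y)) * Real.exp (-(2 * a)) ^ k) := by gcongr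
    _ = _ := by ring

theorem pow_five_mul_exp_le {X y : ℝ} (hy : 0 < y) (hX : 1 ≤ X) (h : 1 ≤ X * (min y 1) ^ 2) :
    X ^ 5 * Real.exp (-(2 * π * X * y)) ≤ 720 * Real.exp (-(π * y)) / (min y 1) ^ 4 := by
  set a := min y 1
  have hsixth : (X * a) ^ 6 ≤ 720 * Real.exp (X * a) := by
    simpa [Nat.factorial] using pow_le_factorial_mul_exp 6 (by positivity : 0 ≤ X * a)
  have hpow : X ^ 5 * a ^ 4 ≤ (X * a) ^ 6 := by
    calc X ^ 5 * a ^ 4 = X ^ 5 * a ^ 4 * 1 := by ring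
      _ ≤ X ^ 5 * a ^ 4 * (X * a ^ 2) := by gcongr
      _ = _ := by ring
  have hexp : Real.exp (X * a) * Real.exp (-(2 * π * X * y)) ≤ Real.exp (-(π * y)) := by
    rw [← Real.exp_add, Real.exp_le_exp]
    have haX : X * a ≤ X * y := by gcongr; exact min_le_left _ _
    nlinarith [le_mul_of_one_le_left hy.le hX, mul_pos (one_pos.trans_le hX) hy, Real.pi_gt_three]
  rw [le_div_iff₀ (by positivity)]
  calc X ^ 5 * Real.exp (-(2 * π * X * y)) * a ^ 4 =
        X ^ 5 * a ^ 4 * Real.exp (-(2 * π * X * y)) := by ring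
    _ ≤ 720 * Real.exp (X * a) * Real.exp (-(2 * π * X * y)) :=
        mul_le_mul_of_nonneg_right (hpow.trans hsixth) (Real.exp_pos _).le
    _ = 720 * (Real.exp (X * a) * Real.exp (-(2 * π * X * y))) := by ring
    _ ≤ _ := by gcongr

theorem norm_saddleGauss_ofReal (η : ℂ) (n : ℝ) :
    ‖saddleGauss η n‖ = Real.exp (-(4 * π * η.im * (n - η.re))) := by
  have hsplit : -(2 * π * I * ((n : ℂ) - η) ^ 2) =
      ((2 * π : ℝ) : ℂ) * (-(I * ((n : ℂ) - η) ^ 2)) := by push_cast; ring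
  rw [saddleGauss, norm_exp, hsplit, re_ofReal_mul, neg_re, I_mul_re, sq, mul_im, sub_re, sub_im,
    ofReal_re, ofReal_im]
  congr 1; ring

theorem five_le_four_pi_mul {X y : ℝ} (hy : 0 < y) (hX : 0 ≤ X) (h : 1 ≤ X * (min y 1) ^ 2) :
    5 ≤ 4 * π * X * y := by
  have hmin : (min y 1) ^ 2 ≤ y := by
    have hpos : 0 < min y 1 := lt_min hy one_pos
    nlinarith [min_le_left y 1, min_le_right y 1]
  nlinarith [mul_le_mul_of_nonneg_left hmin hX, Real.pi_gt_three]

theorem norm_exp_logRatio_sub_ofReal_le {η : ℂ} (hy : 0 < η.im) (hyX : η.im ≤ η.re)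
    (hX : 1 ≤ η.re) (hm : 5 ≤ 4 * π * η.re * η.im) {n : ℝ} (hn : η.re + η.im ≤ n) :
    ‖exp (logRatio η n) - saddleGauss η n‖ ≤
      64 * π / η.re * (2 * ((n - η.re) ^ 3 * Real.exp (-(π * η.im * (n - η.re)))) +
        32 * Real.exp 3 * (η.re ^ 5 * Real.exp (-(2 * π * η.re * η.im))) * (1 / n ^ 2)) := by
  have hn0 : 0 < n := by linarith
  have hratio := norm_exp_logRatio_ofReal_le hy.le hyX hX hm hn
  have hdiff := norm_exp_logRatio_sub_le (η := η) (d := (n : ℂ) - η) (by linarith) (by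
    rw [add_sub_cancel, ofReal_re, ofReal_im]; linarith)
  rw [add_sub_cancel] at hdiff
  have hD0 : 0 < n - η.re := by linarith
  have hgauss : ‖saddleGauss η n‖ ≤ Real.exp (-(π * η.im * (n - η.re))) := by
    have : 0 < π * η.im * (n - η.re) := by positivity
    rw [norm_saddleGauss_ofReal, Real.exp_le_exp]
    linarith
  have hdist : ‖(n : ℂ) - η‖ ≤ 2 * (n - η.re) := by
    have habs := norm_le_abs_re_add_abs_im ((n : ℂ) - η)
    rw [sub_re, sub_im, ofReal_re, ofReal_im, zero_sub, abs_neg, abs_of_pos hD0,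
      abs_of_pos hy] at habs
    linarith
  have hpow : (η.re / n) ^ 5 * (n - η.re) ^ 3 ≤ η.re ^ 5 * (1 / n ^ 2) := by
    calc (η.re / n) ^ 5 * (n - η.re) ^ 3 ≤ (η.re / n) ^ 5 * n ^ 3 := by gcongr; linarith
      _ = η.re ^ 5 * (1 / n ^ 2) := by field_simp
  set E := Real.exp (-(π * η.im * (n - η.re)))
  set F := Real.exp (-(2 * π * η.re * η.im))
  calc _ ≤ _ := hdiff
    _ ≤ 8 * π * (2 * (n - η.re)) ^ 3 / η.re *
        (E + 32 * Real.exp 3 * F * (η.re / n) ^ 5 + E) := by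
      gcongr
      linarith
    _ = 64 * π / η.re * (2 * ((n - η.re) ^ 3 * E) +
        32 * Real.exp 3 * F * ((η.re / n) ^ 5 * (n - η.re) ^ 3)) := by ring
    _ ≤ 64 * π / η.re * (2 * ((n - η.re) ^ 3 * E) +
        32 * Real.exp 3 * F * (η.re ^ 5 * (1 / n ^ 2))) := by gcongr
    _ = _ := by ring

theorem norm_tail_term_le {η : ℂ} (hy : 0 < η.im) (hyX : η.im ≤ η.re) (hX : 1 ≤ η.re)
    (h : 1 ≤ η.re * (min η.im 1) ^ 2) {N : ℕ} (hN : η.re + η.im ≤ N + 1) (k : ℕ) :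
    ‖exp (logRatio η ((N + 1 + k : ℕ) : ℂ)) - saddleGauss η ((N + 1 + k : ℕ) : ℂ)‖ ≤
      64 * π / η.re * (12 * Real.exp π * Real.exp (-(π * η.im)) / (min η.im 1) ^ 3 *
          Real.exp (-(2 * min η.im 1)) ^ k +
        23040 * Real.exp 3 * Real.exp (-(π * η.im)) / (min η.im 1) ^ 4 *
          (1 / ((k : ℝ) + 1) ^ 2)) := by
  set n : ℝ := N + 1 + k
  have hcast : ((N + 1 + k : ℕ) : ℂ) = ((n : ℝ) : ℂ) := by push_cast [n]; rfl
  have hX0 : 0 < η.re := one_pos.trans_le hX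
  have hnk : (k : ℝ) + 1 ≤ n := by linarith [(N.cast_nonneg : (0 : ℝ) ≤ N)]
  have hcube := cube_mul_exp_le (D := n - η.re) (k := k) hy (by linarith)
  have hfifth := pow_five_mul_exp_le hy hX h
  rw [hcast]
  calc _ ≤ _ := norm_exp_logRatio_sub_ofReal_le hy hyX hX (five_le_four_pi_mul hy hX0.le h)
        (by linarith)
    _ ≤ 64 * π / η.re * (2 * (6 * Real.exp π * Real.exp (-(π * η.im)) / (min η.im 1) ^ 3 *
          Real.exp (-(2 * min η.im 1)) ^ k) +
        32 * Real.exp 3 * (720 * Real.exp (-(π * η.im)) / (min η.im 1) ^ 4) *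
          (1 / ((k : ℝ) + 1) ^ 2)) := by gcongr
    _ = _ := by ring

theorem summable_one_div_succ_sq : Summable fun k : ℕ => 1 / ((k : ℝ) + 1) ^ 2 := by
  simpa using (summable_nat_add_iff 1).2 (Real.summable_one_div_nat_pow.2 one_lt_two)

theorem tsum_exp_neg_two_mul_pow_le {a : ℝ} (h0 : 0 < a) (h1 : a ≤ 1) :
    Summable (fun k : ℕ => Real.exp (-(2 * a)) ^ k) ∧
      ∑' k : ℕ, Real.exp (-(2 * a)) ^ k ≤ 3 / (2 * a) := by
  have hgap := two_thirds_mul_le_one_sub_exp h0.le h1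
  have hlt : Real.exp (-(2 * a)) < 1 := Real.exp_lt_one_iff.2 (by linarith)
  refine ⟨summable_geometric_of_lt_one (Real.exp_pos _).le hlt, ?_⟩
  rw [tsum_geometric_of_lt_one (Real.exp_pos _).le hlt,
    show 3 / (2 * a) = (2 / 3 * a)⁻¹ by field_simp]
  exact inv_anti₀ (by positivity) hgap

theorem norm_tsum_sub_tsum_le {ι E : Type*} [NormedAddCommGroup E] [CompleteSpace E]
    {f g : ι → E} {b : ι → ℝ} {B : ℝ} (hg : Summable g) (hb : HasSum b B)
    (hbound : ∀ i, ‖f i - g i‖ ≤ b i) : ‖∑' i, f i - ∑' i, g i‖ ≤ B := by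
  have hdiff : Summable fun i => f i - g i := Summable.of_norm_bounded hb.summable hbound
  have hf : Summable f := (hdiff.add hg).congr fun i => by rw [sub_add_cancel]
  rw [← hf.tsum_sub hg]
  exact tsum_of_norm_bounded hb hbound

theorem exists_norm_tail_sub_le :
    ∃ K : ℝ, 0 < K ∧ ∀ η : ℂ, 0 < η.im → η.im ≤ η.re → 1 ≤ η.re → 1 ≤ η.re * (min η.im 1) ^ 2 →
      ∀ N : ℕ, η.re + η.im ≤ N + 1 →
      ‖(∑' k : ℕ, (-1) ^ (N + 1 + k) * exp (logRatio η ((N + 1 + k : ℕ) : ℂ))) -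
        ∑' k : ℕ, (-1) ^ (N + 1 + k) * saddleGauss η ((N + 1 + k : ℕ) : ℂ)‖ ≤
          K * Real.exp (-(π * η.im)) / (η.re * (min η.im 1) ^ 4) := by
  set Z : ℝ := ∑' k : ℕ, 1 / ((k : ℝ) + 1) ^ 2
  refine ⟨64 * π * (18 * Real.exp π + 23040 * Real.exp 3 * Z), by positivity, ?_⟩
  intro η hy hyX hX h N hN
  set a := min η.im 1
  have ha0 : 0 < a := lt_min hy one_pos
  obtain ⟨hgeo_summable, hgeo_le⟩ := tsum_exp_neg_two_mul_pow_le ha0 (min_le_right _ _)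
  have hmajorant := (((hgeo_summable.hasSum.mul_left
    (12 * Real.exp π * Real.exp (-(π * η.im)) / a ^ 3)).add
      (summable_one_div_succ_sq.hasSum.mul_left
        (23040 * Real.exp 3 * Real.exp (-(π * η.im)) / a ^ 4))).mul_left (64 * π / η.re))
  refine (norm_tsum_sub_tsum_le (hasSum_saddleGauss hy N).summable hmajorant fun k => ?_).trans ?_
  · rw [← mul_sub, norm_mul, norm_pow, norm_neg, norm_one, one_pow, one_mul]
    exact norm_tail_term_le hy hyX hX h hN k
  · calc _ ≤ 64 * π / η.re * (12 * Real.exp π * Real.exp (-(π * η.im)) / a ^ 3 * (3 / (2 * a)) +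
          23040 * Real.exp 3 * Real.exp (-(π * η.im)) / a ^ 4 * Z) := by gcongr
      _ = _ := by field_simp; ring

/-! ### Size of the main term and position of the saddle point -/

theorem norm_cos_le_exp_abs_im (z : ℂ) : ‖cos z‖ ≤ Real.exp |z.im| := by
  have hcosh : ‖cos z‖ ≤ Real.cosh |z.im| := by
    rw [Real.cosh_abs]
    refine le_of_sq_le_sq ?_ (Real.cosh_pos _).le
    rw [sq_norm_cos]
    exact sub_le_self _ (sq_nonneg _)
  refine hcosh.trans ?_
  rw [← Real.cosh_add_sinh]
  exact le_add_of_nonneg_right (Real.sinh_nonneg_iff.2 (abs_nonneg _))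

theorem exp_mul_min_le_norm_sin {η : ℂ} (hy : 0 ≤ η.im) :
    Real.exp (π * η.im) * min η.im 1 / 3 ≤ ‖sin (π * η)‖ := by
  refine le_trans ?_ ((le_abs_self _).trans (abs_sinh_im_le_norm_sin _))
  rw [im_ofReal_mul, Real.sinh_eq]
  have hexp : Real.exp (-(π * η.im)) ≤ Real.exp (π * η.im) * Real.exp (-(2 * min η.im 1)) := by
    rw [← Real.exp_add, Real.exp_le_exp]
    nlinarith [Real.pi_gt_three, min_le_left η.im 1]
  have hlinear := mul_le_mul_of_nonneg_left
    (two_thirds_mul_le_one_sub_exp (le_min hy zero_le_one) (min_le_right η.im 1))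
    (Real.exp_pos (π * η.im)).le
  linarith

theorem le_norm_saddleValue {η : ℂ} (hy : 0 < η.im) :
    min η.im 1 * Real.exp (-(π * η.im)) / 6 ≤ ‖saddleValue η‖ := by
  have hcos : ‖cos (2 * π * η)‖ ≤ Real.exp (π * η.im + π * η.im) := by
    refine (norm_cos_le_exp_abs_im _).trans_eq ?_
    rw [show 2 * (π : ℂ) * η = (2 * π : ℝ) * η by push_cast; ring, im_ofReal_mul,
      abs_of_pos (by positivity)]
    congr 1; ring
  have hcos0 : 0 < ‖cos (2 * π * η)‖ := norm_pos_iff.2 (cos_two_pi_mul_ne_zero hy)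
  have hunit : ‖exp (3 * π * I / 8)‖ = 1 := by
    rw [show 3 * (π : ℂ) * I / 8 = ((3 * π / 8 : ℝ) : ℂ) * I by push_cast; ring]
    exact norm_exp_ofReal_mul_I _
  rw [saddleValue, norm_div, norm_mul, norm_mul, norm_mul, hunit, Complex.norm_ofNat,
    Complex.norm_of_nonneg (Real.sqrt_nonneg 2), mul_one, le_div_iff₀ (by positivity)]
  calc min η.im 1 * Real.exp (-(π * η.im)) / 6 * (2 * ‖cos (2 * π * η)‖)
      ≤ min η.im 1 * Real.exp (-(π * η.im)) / 6 * (2 * Real.exp (π * η.im + π * η.im)) := by gcongr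
    _ = Real.exp (π * η.im) * min η.im 1 / 3 := by
      rw [Real.exp_add, Real.exp_neg]; field_simp; ring
    _ ≤ ‖sin (π * η)‖ := exp_mul_min_le_norm_sin hy.le
    _ ≤ √2 * ‖sin (π * η)‖ :=
      le_mul_of_one_le_left (norm_nonneg _) (Real.one_le_sqrt.2 one_le_two)

theorem two_pi_I_mul_eta_sq (s : ℂ) : 2 * π * I * eta s ^ 2 = s - 1 := by
  rw [eta_sq, mul_div_cancel₀ _ two_pi_I_ne_zero]

theorem four_pi_mul_eta_re_mul_eta_im (s : ℂ) : 4 * π * (eta s).re * (eta s).im = 1 - s.re := by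
  have h := congrArg re (two_pi_I_mul_eta_sq s)
  rw [show (2 * π * I * eta s ^ 2 : ℂ) = (2 * π : ℝ) * (I * eta s ^ 2) by push_cast; ring,
    re_ofReal_mul, I_mul_re, sq, mul_im, sub_re, one_re] at h
  linarith

theorem two_pi_mul_eta_re_sq_sub_eta_im_sq (s : ℂ) :
    2 * π * ((eta s).re ^ 2 - (eta s).im ^ 2) = s.im := by
  have h := congrArg im (two_pi_I_mul_eta_sq s)
  rw [show (2 * π * I * eta s ^ 2 : ℂ) = (2 * π : ℝ) * (I * eta s ^ 2) by push_cast; ring,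
    im_ofReal_mul, I_mul_im, sq, mul_re, sub_im, one_im] at h
  linarith

theorem eta_im_pos_and_lt_re {s : ℂ} (ht : 0 < s.im) (hσ : s.re < 1) :
    0 < (eta s).im ∧ (eta s).im < (eta s).re := by
  have hmul : 0 < (eta s).re * (eta s).im := by
    have h := four_pi_mul_eta_re_mul_eta_im s
    rw [mul_assoc] at h
    exact pos_of_mul_pos_right (h ▸ sub_pos.2 hσ) (by positivity)
  have hsq : 0 < (eta s).re ^ 2 - (eta s).im ^ 2 :=
    pos_of_mul_pos_right (two_pi_mul_eta_re_sq_sub_eta_im_sq s ▸ ht) (by positivity)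
  have harg := (arg_eta s (mem_slitPlane_iff.2 (Or.inl (by simpa using hσ)))).1
  have hquadrant : 0 ≤ (eta s).re ∨ 0 ≤ (eta s).im :=
    neg_pi_div_two_le_arg_iff.1 (by linarith [Real.pi_pos])
  obtain ⟨hre, him⟩ : 0 < (eta s).re ∧ 0 < (eta s).im :=
    (pos_and_pos_or_neg_and_neg_of_mul_pos hmul).resolve_right fun ⟨hre, him⟩ =>
      hquadrant.elim hre.not_ge him.not_ge
  exact ⟨him, lt_of_pow_lt_pow_left₀ 2 hre.le (sub_pos.1 hsq)⟩

theorem powGauss_eq_mul_exp_logRatio {s x : ℂ} (hη : eta s ≠ 0) (hx : x ≠ 0) :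
    powGauss s x = eta s ^ (s - 1) * exp (-(π * I * eta s ^ 2)) * exp (logRatio (eta s) x) := by
  rw [powGauss, cpow_def_of_ne_zero hx, cpow_def_of_ne_zero hη, ← Complex.exp_add,
    ← Complex.exp_add, ← Complex.exp_add, logRatio, ← two_pi_I_mul_eta_sq]
  congr 1; ring

theorem powGauss_natCast (s : ℂ) (n : ℕ) : powGauss s n = (-1) ^ n * (n : ℂ) ^ (s - 1) := by
  have h := quad_natCast_one 0 n
  rw [quad, mul_zero, zero_mul, add_zero, mul_zero, Complex.exp_zero, ofReal_one, mul_one,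
    mul_one] at h
  rw [powGauss, h, mul_comm]

theorem natCast_cpow_eq_mul_exp_logRatio {s : ℂ} (hη : eta s ≠ 0) {n : ℕ} (hn : n ≠ 0) :
    (n : ℂ) ^ (s - 1) = eta s ^ (s - 1) * exp (-(π * I * eta s ^ 2)) *
      ((-1) ^ n * exp (logRatio (eta s) n)) := by
  rw [mul_left_comm, ← powGauss_eq_mul_exp_logRatio hη (Nat.cast_ne_zero.2 hn), powGauss_natCast,
    ← mul_assoc, ← mul_pow, neg_one_mul, neg_neg, one_pow, one_mul]

theorem auxR_eq_chi_mul_eta_cpow_mul {s : ℂ} (hs : s.re < -1) (hη : eta s ≠ 0) (N : ℕ) :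
    auxR s = chi s * (eta s ^ (s - 1) * exp (-(π * I * eta s ^ 2))) *
      ((∑' k : ℕ, (-1) ^ (N + 1 + k) * exp (logRatio (eta s) ((N + 1 + k : ℕ) : ℂ))) -
        lineInt (fun x => exp (logRatio (eta s) x)) (N + 1 / 2)) := by
  have hline : lineInt (powGauss s) (N + 1 / 2) = eta s ^ (s - 1) * exp (-(π * I * eta s ^ 2)) *
      lineInt (fun x => exp (logRatio (eta s) x)) (N + 1 / 2) := by
    rw [← lineInt_const_mul]
    unfold lineInt
    congr 1; ext v
    have hx : (N : ℂ) + 1 / 2 + v * rot ≠ 0 := fun h => by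
      have hre := rot_mul_line_re N v
      rw [h, mul_zero, zero_re] at hre
      exact (show (0 : ℝ) < √2 / 2 * (N + 1 / 2) by positivity).ne hre
    rw [powGauss_eq_mul_exp_logRatio hη hx]
  rw [auxR_eq_chi_mul_tsum_sub_lineInt hs N, hline, tsum_congr fun k =>
    natCast_cpow_eq_mul_exp_logRatio hη (n := N + 1 + k) (by omega), tsum_mul_left]
  ring

/-! ### The relative error -/

theorem exists_norm_tsum_sub_lineInt_add_saddleValue_le :
    ∃ K : ℝ, 0 < K ∧ ∀ η : ℂ, 0 < η.im → η.im ≤ η.re → 1 ≤ η.re → 1 ≤ η.re * (min η.im 1) ^ 2 →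
      ∀ N : ℕ, (N : ℝ) ≤ η.re + η.im → η.re + η.im ≤ N + 1 →
      ‖(∑' k : ℕ, (-1) ^ (N + 1 + k) * exp (logRatio η ((N + 1 + k : ℕ) : ℂ))) -
        lineInt (fun x => exp (logRatio η x)) (N + 1 / 2) + saddleValue η‖ ≤
          K * Real.exp (-(π * η.im)) / (η.re * (min η.im 1) ^ 4) := by
  obtain ⟨K, hK0, hK⟩ := exists_norm_tail_sub_le
  refine ⟨K + 32 * π * Real.exp 246 * √π, by positivity, fun η hy hyX hX hXa N hN₁ hN₂ => ?_⟩
  have hmodel := tsum_saddleGauss_sub_lineInt hy N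
  have hmin : 0 < min η.im 1 := lt_min hy one_pos
  have hX0 : 0 < η.re := one_pos.trans_le hX
  rw [← neg_eq_iff_eq_neg.2 hmodel, ← sub_eq_add_neg, sub_sub_sub_comm, add_mul, add_div]
  refine (norm_sub_le _ _).trans (add_le_add (hK η hy hyX hX hXa N hN₂) ?_)
  calc _ ≤ 32 * π * Real.exp 246 / η.re * Real.exp (-(π * η.im)) * √π :=
        norm_lineInt_sub_le hy.le hX hN₁ hN₂
    _ = 32 * π * Real.exp 246 * √π * Real.exp (-(π * η.im)) / η.re := by ring
    _ ≤ _ := by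
      gcongr
      exact mul_le_of_le_one_right hX0.le (pow_le_one₀ hmin.le (min_le_right _ _))

theorem exists_auxR_eq_mainTerm_mul :
    ∃ K : ℝ, 0 < K ∧ ∀ s : ℂ, 0 < s.im → s.re < -1 →
      1 ≤ (eta s).re * (min (eta s).im 1) ^ 5 →
      ∃ U : ℂ, auxR s = mainTerm s * (1 + U) ∧
        ‖U‖ ≤ K / ((eta s).re * (min (eta s).im 1) ^ 5) := by
  obtain ⟨K, hK0, hK⟩ := exists_norm_tsum_sub_lineInt_add_saddleValue_le
  refine ⟨6 * K, by positivity, fun s ht hs h => ?_⟩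
  obtain ⟨hy, hyX⟩ := eta_im_pos_and_lt_re ht (by linarith)
  have hη0 : eta s ≠ 0 := fun h0 => hy.ne' (by rw [h0, zero_im])
  have hmin0 : 0 < min (eta s).im 1 := lt_min hy one_pos
  have hmin1 : min (eta s).im 1 ≤ 1 := min_le_right _ _
  have hX0 : 0 < (eta s).re := hy.trans hyX
  have hX1 : 1 ≤ (eta s).re := h.trans (mul_le_of_le_one_right hX0.le (pow_le_one₀ hmin0.le hmin1))
  have hX2 : 1 ≤ (eta s).re * (min (eta s).im 1) ^ 2 := h.trans <|
    mul_le_mul_of_nonneg_left (pow_le_pow_of_le_one hmin0.le hmin1 (by norm_num)) hX0.le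
  set N : ℕ := ⌊(eta s).re + (eta s).im⌋₊
  have herror := hK (eta s) hy hyX.le hX1 hX2 N (Nat.floor_le (by linarith))
    (Nat.lt_floor_add_one _).le
  have hrep := auxR_eq_chi_mul_eta_cpow_mul hs hη0 N
  set D := (∑' k : ℕ, (-1) ^ (N + 1 + k) * exp (logRatio (eta s) ((N + 1 + k : ℕ) : ℂ))) -
    lineInt (fun x => exp (logRatio (eta s) x)) (N + 1 / 2)
  have hlower := le_norm_saddleValue hy
  have hvalue : saddleValue (eta s) ≠ 0 :=
    norm_pos_iff.1 ((by positivity : (0 : ℝ) < _).trans_le hlower)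
  refine ⟨(D + saddleValue (eta s)) / -saddleValue (eta s), ?_, ?_⟩
  · have hmain : mainTerm s =
        chi s * (eta s ^ (s - 1) * exp (-(π * I * eta s ^ 2))) * -saddleValue (eta s) := by
      rw [mainTerm, saddleValue]; ring
    rw [hrep, hmain]
    field_simp; ring
  · rw [norm_div, norm_neg]
    refine (div_le_div₀ (by positivity) herror (by positivity) hlower).trans_eq ?_
    field_simp

theorem one_div_eta_re_mul_min_pow_le {s : ℂ} (ht : 2 ≤ s.im) (hσ : s.re < 1) :
    1 / ((eta s).re * (min (eta s).im 1) ^ 5) ≤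
      (4 * π) ^ 5 * (s.im ^ 2 / (1 - s.re) ^ 5 + 1 / √s.im) := by
  have hπ := Real.pi_gt_three
  have ht0 : 0 < s.im := by linarith
  obtain ⟨hy, hyX⟩ := eta_im_pos_and_lt_re ht0 hσ
  have hδ := four_pi_mul_eta_re_mul_eta_im s
  have him := two_pi_mul_eta_re_sq_sub_eta_im_sq s
  set X := (eta s).re
  set y := (eta s).im
  have hX0 : 0 < X := hy.trans hyX
  rw [mul_add]
  rcases le_total y 1 with hy1 | hy1
  · have hX4 : X ^ 4 ≤ s.im ^ 2 := by
      rw [show X ^ 4 = (X ^ 2) ^ 2 by ring]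
      have hy2 : y ^ 2 ≤ 1 := pow_le_one₀ hy.le hy1
      gcongr
      nlinarith
    refine le_add_of_le_of_nonneg ?_ (by positivity)
    calc 1 / (X * min y 1 ^ 5) = (4 * π) ^ 5 * (X ^ 4 / (1 - s.re) ^ 5) := by
          rw [min_eq_left hy1, ← hδ]; field_simp
      _ ≤ _ := by gcongr
  · have hsqrt : √s.im ≤ (4 * π) ^ 5 * X := by
      calc √s.im ≤ 4 * π * X := by
            rw [Real.sqrt_le_left (by positivity)]
            nlinarith [mul_pos Real.pi_pos (pow_pos hX0 2), mul_pos Real.pi_pos (pow_pos hy 2)]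
        _ ≤ (4 * π) ^ 5 * X := by
            gcongr
            exact le_self_pow₀ (by linarith) (by norm_num)
    refine le_add_of_nonneg_of_le (by positivity) ?_
    rw [min_eq_right hy1, one_pow, mul_one, mul_one_div,
      div_le_div_iff₀ hX0 (Real.sqrt_pos.2 ht0), one_mul]
    exact hsqrt

theorem sq_div_pow_five_le {A t δ : ℝ} (hA : 0 < A) (ht : 0 < t) (h : A * t ^ (2 / 5 : ℝ) ≤ δ) :
    t ^ 2 / δ ^ 5 ≤ 1 / A ^ 5 := by
  have htpow : (t ^ (2 / 5 : ℝ)) ^ 5 = t ^ 2 := by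
    rw [← Real.rpow_natCast, ← Real.rpow_mul ht.le, ← Real.rpow_natCast]; norm_num
  calc t ^ 2 / δ ^ 5 ≤ t ^ 2 / (A * t ^ (2 / 5 : ℝ)) ^ 5 := by gcongr
    _ = 1 / A ^ 5 := by rw [mul_pow, htpow]; field_simp

theorem sq_div_pow_five_add_one_div_sqrt_le {A t δ : ℝ} (hA : 0 < A) (ht : Real.exp 1 ≤ t)
    (h : A * t ^ (2 / 5 : ℝ) * Real.log t ≤ δ) :
    t ^ 2 / δ ^ 5 + 1 / √t ≤ (1 / A ^ 5 + 2) * Real.log t ^ (-(1 / 5) : ℝ) := by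
  have ht0 : 0 < t := (Real.exp_pos 1).trans_le ht
  have hlog : 1 ≤ Real.log t := (Real.le_log_iff_exp_le ht0).2 ht
  have hlog0 : 0 < Real.log t := one_pos.trans_le hlog
  have hinv : 1 / Real.log t ≤ Real.log t ^ (-(1 / 5) : ℝ) := by
    rw [one_div, ← Real.rpow_neg_one]
    exact Real.rpow_le_rpow_of_exponent_le hlog (by norm_num)
  have hpower : t ^ 2 / δ ^ 5 ≤ 1 / A ^ 5 * (1 / Real.log t) := by
    refine (sq_div_pow_five_le (mul_pos hA hlog0) ht0 (by linarith)).trans ?_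
    rw [mul_pow, one_div_mul_one_div]
    gcongr
    exact le_self_pow₀ hlog (by norm_num)
  have hsqrt : 1 / √t ≤ 2 * (1 / Real.log t) := by
    have h2 := Real.log_le_self (Real.sqrt_nonneg t)
    rw [Real.log_sqrt ht0.le] at h2
    rw [mul_one_div, div_le_div_iff₀ (Real.sqrt_pos.2 ht0) hlog0]
    linarith
  rw [add_mul]
  refine add_le_add (hpower.trans ?_) (hsqrt.trans ?_) <;> gcongr

theorem exists_auxR_eq_mainTerm_mul_of_lt_one :
    ∃ C : ℝ, 1 ≤ C ∧ ∀ s : ℂ, 2 ≤ s.im → s.re < -1 →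
      C * (s.im ^ 2 / (1 - s.re) ^ 5 + 1 / √s.im) < 1 →
        ∃ U : ℂ, auxR s = mainTerm s * (1 + U) ∧
          ‖U‖ ≤ C * (s.im ^ 2 / (1 - s.re) ^ 5 + 1 / √s.im) := by
  obtain ⟨K, hK0, hK⟩ := exists_auxR_eq_mainTerm_mul
  have hP : 1 ≤ (4 * π) ^ 5 := one_le_pow₀ (by linarith [Real.pi_gt_three])
  refine ⟨(K + 1) * (4 * π) ^ 5, one_le_mul_of_one_le_of_one_le (by linarith) hP,
    fun s ht hs hlt => ?_⟩
  obtain ⟨hy, hyX⟩ := eta_im_pos_and_lt_re (s := s) (by linarith) (by linarith)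
  have hrate := one_div_eta_re_mul_min_pow_le ht (by linarith)
  have hM0 : 0 < (eta s).re * (min (eta s).im 1) ^ 5 :=
    mul_pos (hy.trans hyX) (pow_pos (lt_min hy one_pos) 5)
  have hinv0 := (one_div_pos.2 hM0).le
  rw [mul_assoc] at hlt ⊢
  have hM1 : 1 ≤ (eta s).re * (min (eta s).im 1) ^ 5 :=
    (one_div_le_one_div hM0 one_pos).1 (by nlinarith)
  obtain ⟨U, hU, hUM⟩ := hK s (by linarith) hs hM1
  refine ⟨U, hU, hUM.trans ?_⟩
  rw [div_eq_mul_one_div]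
  exact mul_le_mul (by linarith) hrate hinv0 (by linarith)

end RiemannAux

theorem mainTheorem2_general :
    ∃ A t₀ C : ℝ, 0 < A ∧ 0 < t₀ ∧ 0 < C ∧
      ∀ s : ℂ, t₀ < s.im → A * s.im ^ (2 / 5 : ℝ) ≤ 1 - s.re →
        ∃ U : ℂ, RiemannAux.auxR s = RiemannAux.mainTerm s * (1 + U) ∧ ‖U‖ < 1 ∧
          ‖U‖ ≤ C * (s.im ^ 2 / (1 - s.re) ^ 5 + 1 / √s.im) := by
  obtain ⟨C, hC, hrep⟩ := RiemannAux.exists_auxR_eq_mainTerm_mul_of_lt_one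
  refine ⟨4 * C, (4 * C) ^ 2, C, by positivity, by positivity, by positivity,
    fun s ht hσ => ?_⟩
  have ht2 : 2 ≤ s.im := by nlinarith
  have hs : s.re < -1 := by
    linarith [le_mul_of_one_le_right (by positivity : 0 ≤ 4 * C)
      (Real.one_le_rpow (by linarith : 1 ≤ s.im) (by norm_num : (0 : ℝ) ≤ 2 / 5))]
  have hpower : s.im ^ 2 / (1 - s.re) ^ 5 ≤ 1 / (4 * C) :=
    (RiemannAux.sq_div_pow_five_le (by positivity) (by linarith) hσ).trans
      (one_div_le_one_div_of_le (by positivity) (le_self_pow₀ (by linarith) (by norm_num)))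
  have hsqrt : 1 / √s.im ≤ 1 / (4 * C) :=
    one_div_le_one_div_of_le (by positivity) (Real.le_sqrt_of_sq_le ht.le)
  have hlt : C * (s.im ^ 2 / (1 - s.re) ^ 5 + 1 / √s.im) < 1 := by
    calc _ ≤ C * (1 / (4 * C) + 1 / (4 * C)) := by gcongr
      _ = 1 / 2 := by field_simp; norm_num
      _ < 1 := one_half_lt_one
  obtain ⟨U, hU, hUle⟩ := hrep s ht2 hs hlt
  exact ⟨U, hU, hUle.trans_lt hlt, hUle⟩

theorem mainTheorem2 :
    ∃ A t₀ C : ℝ, 0 < A ∧ 0 < t₀ ∧ 0 < C ∧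
      ∀ s : ℂ, t₀ < s.im → A * s.im ^ (2 / 5 : ℝ) * Real.log s.im ≤ 1 - s.re →
        ∃ U : ℂ, RiemannAux.auxR s = RiemannAux.mainTerm s * (1 + U) ∧
          ‖U‖ < 1 ∧ ‖U‖ ≤ C * Real.log s.im ^ (-(1 / 5) : ℝ) := by
  obtain ⟨A, t₀, C, hA, ht₀, hC, h⟩ := mainTheorem2_general
  refine ⟨A, max t₀ (Real.exp 1), C * (1 / A ^ 5 + 2), hA, ht₀.trans_le (le_max_left _ _),
    by positivity, fun s ht hσ => ?_⟩
  have hexp : Real.exp 1 ≤ s.im := (le_max_right _ _).trans ht.le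
  have hlog : 1 ≤ Real.log s.im := (Real.le_log_iff_exp_le ((Real.exp_pos 1).trans_le hexp)).2 hexp
  have hrpow : 0 ≤ s.im ^ (2 / 5 : ℝ) := Real.rpow_nonneg ((Real.exp_pos 1).le.trans hexp) _
  obtain ⟨U, hU, hU1, hUle⟩ := h s ((le_max_left _ _).trans_lt ht)
    ((le_mul_of_one_le_right (mul_nonneg hA.le hrpow) hlog).trans hσ)
  refine ⟨U, hU, hU1, hUle.trans ?_⟩
  rw [mul_assoc C]
  exact mul_le_mul_of_nonneg_left
    (RiemannAux.sq_div_pow_five_add_one_div_sqrt_le hA hexp hσ) hC.le
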